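/- **Setting.** Let $(\mathcal X,d)$ be a metric space with a Borel measure $\mu$ which is finite on balls and doubling: for some $n>0$ and $C_D$, $$\mu(B(x,\lambda r))\le C_D\lambda^n\mu(B(x,r))\qquad\text{for all }x\in\mathcal X,\ r>0,\ \lambda\ge1 .$$ Fix a system of dyadic cubes on $\mathcal X$, i.e. collections $\mathcal D_k$ $(k\in\mathbb Z)$ of open sets and constants $\rho\in(0,1)$, $c_0,C_0>0$, $C_1$ such that: * $\mu(\mathcal X\setminus\bigcup_{Q\in\mathcal D_k}Q)=0$ for all $k$; * if $l\ge k$, $Q\in\mathcal D_l$, $R\in\mathcal D_k$, then $Q\subset R$ or $Q\cap R=\emptyset$; * if $l<k$, each $Q\in\mathcal D_k$ lies in exactly one $R\in\mathcal D_l$; * $\operatorname{diam}Q\le C_1\rho^k$ for $Q\in\mathcal D_k$; * each $Q\in\mathcal D_k$ has a center $x_Q\in\mathcal X$ with $B(x_Q,c_0\rho^k)\subset Q\subset B(x_Q,C_0\rho^k)$. For $1\le p<\infty$, $X^{p,2}$ is the space of measurable $f:\mathcal X\to\mathbb C$ with $\|f\|_{X^{p,2}}=\big(\sum_{Q\in\mathcal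 D_0}\|f\|_{L^2(Q)}^p\big)^{1/p}<\infty$. Let $w=(w_1,\dots,w_\ell):\mathcal X\times\mathcal X\to\mathbb R^\ell$, measurable in the second variable, satisfy $K_0^{-1}d(x,y)\le|w(x,y)|\le K_0d(x,y)$ (Euclidean norm) for some $K_0>0$. Let $\mathscr D(w)\subset L^2(\mathcal X)$ be a dense linear subspace such that, for all $z\in\mathcal X$ and $1\le j\le\ell$: * $w_j(z,\cdot)f\in\mathscr D(w)$ for all $f\in\mathscr D(w)$; * $\mathscr D(w)$ is a core for multiplication by $w_j(z,\cdot)^m$, for each integer $m\ge0$: if $f\in L^2$ and $w_j(z,\cdot)^mf\in L^2$, there are $f_i\in\mathscr D(w)$ with $f_i\to f$ and $w_j(z,\cdot)^mf_i\to w_j(z,\cdot)^mf$ in $L^2$. Let $\mathscr D'(w)$ be the space of conjugate-linear functionals on $\mathscr D(w)$, in which $u\in L^2$ is the functional $g\mapsto\int u\bar g\,d\mu$, and let $w_{j,z}$ denote multiplication by $w_j(z,\cdot)$, acting on $\mathscr D(w)$, and on $\mathscr D'(w)$ by transposition. For $T$ bounded on $L^2(\mathcal X)$ define $\mathrm{Ad}^k_{j,z}(T):\mathscr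 D(w)\to\mathscr D'(w)$ by $\mathrm{Ad}^1_{j,z}(T)=[w_{j,z},T]$ and $\mathrm{Ad}^{k+1}_{j,z}(T)=[w_{j,z},\mathrm{Ad}^k_{j,z}(T)]$. **Theorem.** Let $T$ be a bounded operator on $L^2(\mathcal X)$ and $B_0\ge1$. Assume that, for all $1\le k\le\lfloor n/2\rfloor+1$, $1\le j\le\ell$ and $z\in\mathcal X$, $\mathrm{Ad}^k_{j,z}(T)$ extends to a bounded operator on $L^2(\mathcal X)$ with $$\|\mathrm{Ad}^k_{j,z}(T)\|_{2\to2}\le B_0^k .$$ Then, for $1\le p\le2$, we have $X^{p,2}\subset L^2(\mathcal X)$, $T$ maps $X^{p,2}$ into itself, and $$\|Tf\|_{X^{p,2}}\le C\,B_0^{\,n(1/p-1/2)}\,\|f\|_{X^{p,2}}\qquad\text{for all }f\in X^{p,2},$$ where $C$ depends only on $n$, an upper bound for $\|T\|_{2\to2}$, $K_0$, $\ell$, $C_D$, $c_0$ and $C_0$. -/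

import Mathlib

open MeasureTheory Metric Set
open scoped ENNReal

noncomputable section

namespace Amalgam

variable {X : Type*} [MetricSpace X] [MeasurableSpace X]

set_option linter.unusedSectionVars false

/-- Balls have finite measure and `μ(B(x, λ r)) ≤ C λ ^ n μ(B(x, r))` for all `λ ≥ 1`, `r > 0`:
the measure is doubling, with doubling dimension `n` and constant `C`. -/
structure IsDoubling (μ : Measure X) (n C : ℝ) : Prop where
  finite_ball : ∀ (x : X) (r : ℝ), μ (ball x r) < ∞
  ball_le : ∀ (x : X) (r : ℝ), 0 < r → ∀ t : ℝ, 1 ≤ t →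
    μ (ball x (t * r)) ≤ ENNReal.ofReal (C * t ^ n) * μ (ball x r)

/-- A system of (Christ) dyadic cubes. `cubes k` is the collection of the cubes of generation `k`,
of size comparable with `ρ ^ k`; they contain balls of radius `c₀ ρ ^ k`, and are contained in the
concentric balls of radius `C₀ ρ ^ k`. -/
structure DyadicCubes (μ : Measure X) (c₀ C₀ : ℝ) where
  cubes : ℤ → Set (Set X)
  ρ : ℝ
  C₁ : ℝ
  ρ_pos : 0 < ρ
  ρ_lt_one : ρ < 1
  isOpen : ∀ k, ∀ Q ∈ cubes k, IsOpen Q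
  ae_cover : ∀ k, μ (⋃₀ cubes k)ᶜ = 0
  nested : ∀ k l, k ≤ l → ∀ Q ∈ cubes l, ∀ R ∈ cubes k, Q ⊆ R ∨ Disjoint Q R
  parent : ∀ k l, l < k → ∀ Q ∈ cubes k, ∃! R, R ∈ cubes l ∧ Q ⊆ R
  diam_le : ∀ k, ∀ Q ∈ cubes k, diam Q ≤ C₁ * ρ ^ k
  center : ∀ k, ∀ Q ∈ cubes k, ∃ x : X, ball x (c₀ * ρ ^ k) ⊆ Q ∧ Q ⊆ ball x (C₀ * ρ ^ k)

/-- The amalgam norm `(∑_{Q ∈ 𝒟_ν} ‖f‖_{L^q(Q)} ^ p) ^ (1 / p)`, a supremum if `p = ∞`. -/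
def DyadicCubes.amalgamNorm {μ : Measure X} {c₀ C₀ : ℝ} (𝒬 : DyadicCubes μ c₀ C₀)
    (ν : ℤ) (p q : ℝ≥0∞) (f : X → ℂ) : ℝ≥0∞ :=
  if p = ∞ then ⨆ Q : 𝒬.cubes ν, eLpNorm f q (μ.restrict (Q : Set X))
  else (∑' Q : 𝒬.cubes ν, eLpNorm f q (μ.restrict (Q : Set X)) ^ p.toReal) ^ (1 / p.toReal)

/-- A (vector valued) weight function: `|w(x, y)|` (Euclidean norm) is equivalent to `d(x, y)`. -/
structure IsWeight (μ : Measure X) {ℓ : ℕ} (K₀ : ℝ)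
    (w : X → X → EuclideanSpace ℝ (Fin ℓ)) : Prop where
  aemeasurable : ∀ x j, AEMeasurable (fun y => w x y j) μ
  lower : ∀ x y, K₀⁻¹ * dist x y ≤ ‖w x y‖
  upper : ∀ x y, ‖w x y‖ ≤ K₀ * dist x y

/-- A space of test functions associated with the weight `w`: a dense subspace of `L²`, which is
invariant under multiplication by the functions `w_j(x, ·)` and is a core for the
(maximal) multiplication operators by their powers. -/
structure TestSpace (μ : Measure X) {ℓ : ℕ} (w : X → X → EuclideanSpace ℝ (Fin ℓ)) where
  carrier : Submodule ℂ (Lp ℂ 2 μ)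
  dense : Dense (carrier : Set (Lp ℂ 2 μ))
  memLp_mul : ∀ x j, ∀ f ∈ carrier, MemLp (fun y => (w x y j : ℂ) * f y) 2 μ
  mul_mem : ∀ x j, ∀ f (hf : f ∈ carrier), (memLp_mul x j f hf).toLp _ ∈ carrier
  core : ∀ x j (m : ℕ) (f : Lp ℂ 2 μ), MemLp (fun y => (w x y j : ℂ) ^ m * f y) 2 μ →
    ∀ ε : ℝ, 0 < ε → ∃ g ∈ carrier, ‖f - g‖ < ε ∧
      eLpNorm (fun y => (w x y j : ℂ) ^ m * (f y - g y)) 2 μ < ENNReal.ofReal ε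

namespace TestSpace

variable {μ : Measure X} {ℓ : ℕ} {w : X → X → EuclideanSpace ℝ (Fin ℓ)}

/-- Multiplication by `w_j(x, ·)`, as a linear map on the test space. -/
def mulOp (D : TestSpace μ w) (x : X) (j : Fin ℓ) : D.carrier →ₗ[ℂ] D.carrier where
  toFun f := ⟨(D.memLp_mul x j f f.2).toLp _, D.mul_mem x j f f.2⟩
  map_add' f g := by
    apply Subtype.ext
    apply Lp.ext
    refine (MemLp.coeFn_toLp (D.memLp_mul x j _ (f + g).2)).trans (Filter.EventuallyEq.trans ?_
      (Lp.coeFn_add ((D.memLp_mul x j f f.2).toLp _) ((D.memLp_mul x j g g.2).toLp _)).symm)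
    filter_upwards [Lp.coeFn_add (f : Lp ℂ 2 μ) (g : Lp ℂ 2 μ),
      MemLp.coeFn_toLp (D.memLp_mul x j f f.2), MemLp.coeFn_toLp (D.memLp_mul x j g g.2)]
      with y h1 h2 h3
    simp only [Submodule.coe_add, Pi.add_apply] at *
    rw [h1, h2, h3, mul_add]
  map_smul' c f := by
    apply Subtype.ext
    apply Lp.ext
    refine (MemLp.coeFn_toLp (D.memLp_mul x j _ (c • f).2)).trans (Filter.EventuallyEq.trans ?_
      (Lp.coeFn_smul c ((D.memLp_mul x j f f.2).toLp _)).symm)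
    filter_upwards [Lp.coeFn_smul c (f : Lp ℂ 2 μ),
      MemLp.coeFn_toLp (D.memLp_mul x j f f.2)] with y h1 h2
    simp only [Submodule.coe_smul, Pi.smul_apply, smul_eq_mul] at *
    rw [h1, h2]
    ring

/-- Linear maps from the test space to its (conjugate linear) dual. A function `u` of `L²` is
identified with the functional `g ↦ ⟨u, g⟩ = ∫ u ḡ`. -/
abbrev OpToDual (D : TestSpace μ w) : Type _ :=
  D.carrier →ₗ[ℂ] D.carrier →ₗ⋆[ℂ] ℂ

/-- A bounded operator on `L²`, seen as a map from the test space to its dual. -/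
def ofL2 (D : TestSpace μ w) (T : Lp ℂ 2 μ →L[ℂ] Lp ℂ 2 μ) : D.OpToDual :=
  ((innerₛₗ ℂ : Lp ℂ 2 μ →ₗ⋆[ℂ] Lp ℂ 2 μ →ₗ[ℂ] ℂ).flip.compl₂ D.carrier.subtype).comp
    ((T : Lp ℂ 2 μ →ₗ[ℂ] Lp ℂ 2 μ).comp D.carrier.subtype)

theorem ofL2_apply (D : TestSpace μ w) (T : Lp ℂ 2 μ →L[ℂ] Lp ℂ 2 μ) (f g : D.carrier) :
    D.ofL2 T f g = inner ℂ (g : Lp ℂ 2 μ) (T f) := rfl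

/-- The commutator `[w_{j,x}, S]`; multiplication acts on the dual by transposition. -/
def comm (D : TestSpace μ w) (x : X) (j : Fin ℓ) (S : D.OpToDual) : D.OpToDual :=
  S.compl₂ (D.mulOp x j) - S.comp (D.mulOp x j)

theorem comm_apply (D : TestSpace μ w) (x : X) (j : Fin ℓ) (S : D.OpToDual) (f g : D.carrier) :
    D.comm x j S f g = S f (D.mulOp x j g) - S (D.mulOp x j f) g := rfl

/-- The iterated commutator `Ad_{j,x}^k(T) = [w_{j,x}, [w_{j,x}, … [w_{j,x}, T]]]`. -/
def Ad (D : TestSpace μ w) (x : X) (j : Fin ℓ) (T : Lp ℂ 2 μ →L[ℂ] Lp ℂ 2 μ) : ℕ → D.OpToDual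
  | 0 => D.ofL2 T
  | k + 1 => D.comm x j (Ad D x j T k)

/-- `S` extends to a bounded operator on `L²` of norm at most `b`. -/
def ExtendsWithNormLE (D : TestSpace μ w) (S : D.OpToDual) (b : ℝ) : Prop :=
  ∃ A : Lp ℂ 2 μ →L[ℂ] Lp ℂ 2 μ, S = D.ofL2 A ∧ ‖A‖ ≤ b

end TestSpace

end Amalgam

end

noncomputable section

namespace Amalgam

variable {X : Type*} [MetricSpace X] [MeasurableSpace X]

set_option linter.unusedSectionVars false

/-! ### Iterated commutators and powers of the weight -/

section Commutators

variable {μ : Measure X} {ℓ : ℕ} {w : X → X → EuclideanSpace ℝ (Fin ℓ)} {K₀ : ℝ}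

namespace TestSpace

/-! Bounded commutators mean off-diagonal decay. If `f` lives on a cube with centre `z`, each factor
`w_j(z, ·)` in `w_j ^ N T f` either falls on `f`, costing `K₀ r`, or is absorbed by a commutator,
costing `B₀`; so `‖w_j ^ N T f‖ ≤ M (K₀ r + B₀) ^ N ‖f‖`. Hence `T f` decays in the mean like `(1 +
d(z, ·) / B₀) ^ (-N)`. With `N = ⌊n / 2⌋ + 1` we have `2N > n`, and doubling allows `O((t B₀) ^ n)`
cubes within distance `t B₀` for `t ≥ 1`, so Cauchy–Schwarz gives `∑_Q ‖T f‖_{L²(Q)} ≲ B₀ ^ (n / 2)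
‖f‖` (`TestSpace.sum_eLpNorm_le`).

This is the endpoint `p = 1`; `p = 2` is boundedness on `L²`. Interpolation with `θ = 2 - 2 / p`
gives the power `(n / 2)(2 / p - 1)` of `B₀` (`sum_norm_cut_rpow_le`). It reduces to a scalar finite
matrix: `F` and `T F` are cut along the cubes, and the normalized pieces are orthonormal.

Since `w_j ^ N T f` is not known to be in `L²`, the first estimate is proved by duality, the core
property supplying the test vectors. -/

theorem coeFn_mulOp (D : TestSpace μ w) (x : X) (j : Fin ℓ) (f : D.carrier) :
    (D.mulOp x j f : Lp ℂ 2 μ) =ᵐ[μ] fun y => (w x y j : ℂ) * (f : Lp ℂ 2 μ) y :=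
  MemLp.coeFn_toLp (D.memLp_mul x j f f.2)

theorem coeFn_mulOp_pow (D : TestSpace μ w) (x : X) (j : Fin ℓ) (m : ℕ) (f : D.carrier) :
    ((D.mulOp x j ^ m) f : Lp ℂ 2 μ) =ᵐ[μ] fun y => (w x y j : ℂ) ^ m * (f : Lp ℂ 2 μ) y := by
  induction m with
  | zero => simp
  | succ m ih =>
    rw [pow_succ', Module.End.mul_apply]
    filter_upwards [D.coeFn_mulOp x j ((D.mulOp x j ^ m) f), ih] with y h1 h2
    rw [h1, h2]
    ring

/-- The graph of multiplication by `w_j(x, ·) ^ m` on `L²` is contained in the closure of the graph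
of its restriction to the test space. -/
theorem mem_closure_graph (D : TestSpace μ w) (x : X) (j : Fin ℓ) (m : ℕ) (f h : Lp ℂ 2 μ)
    (hh : h =ᵐ[μ] fun y => (w x y j : ℂ) ^ m * f y) :
    (f, h) ∈ closure (range fun g : D.carrier =>
      ((g : Lp ℂ 2 μ), ((D.mulOp x j ^ m) g : Lp ℂ 2 μ))) := by
  rw [Metric.mem_closure_iff]
  intro ε hε
  obtain ⟨g, hg, h1, h2⟩ := D.core x j m f ((memLp_congr_ae hh).1 (Lp.memLp h)) ε hε
  refine ⟨_, ⟨⟨g, hg⟩, rfl⟩, ?_⟩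
  rw [Prod.dist_eq, max_lt_iff]
  refine ⟨by rwa [dist_eq_norm], ?_⟩
  simp only
  rw [dist_eq_norm, Lp.norm_def]
  refine (ENNReal.toReal_lt_of_lt_ofReal ?_)
  refine lt_of_eq_of_lt (eLpNorm_congr_ae ?_) h2
  filter_upwards [hh, D.coeFn_mulOp_pow x j m ⟨g, hg⟩, Lp.coeFn_sub h _] with y h1 h2 h3
  rw [h3, Pi.sub_apply, h1, h2]
  ring

/-- The Leibniz rule for the commutator, for a function in the domain of the multiplication
operator. -/
theorem inner_mulOp_apply (D : TestSpace μ w) (x : X) (j : Fin ℓ) {S : D.OpToDual}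
    {A B : Lp ℂ 2 μ →L[ℂ] Lp ℂ 2 μ} (hA : S = D.ofL2 A) (hB : D.comm x j S = D.ofL2 B)
    (f h : Lp ℂ 2 μ) (hh : h =ᵐ[μ] fun y => (w x y j : ℂ) * f y) (g : D.carrier) :
    inner ℂ (D.mulOp x j g : Lp ℂ 2 μ) (A f) =
      inner ℂ (g : Lp ℂ 2 μ) (A h) + inner ℂ (g : Lp ℂ 2 μ) (B f) := by
  -- Both sides are continuous in `(f, h)`, so the core property with exponent 1 reduces to `f` in
  -- the test space, where this is the definition of the commutator.
  have hcl : IsClosed {q : Lp ℂ 2 μ × Lp ℂ 2 μ |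
      inner ℂ (D.mulOp x j g : Lp ℂ 2 μ) (A q.1) =
      inner ℂ (g : Lp ℂ 2 μ) (A q.2) + inner ℂ (g : Lp ℂ 2 μ) (B q.1)} :=
    isClosed_eq (by fun_prop) (by fun_prop)
  refine hcl.closure_subset_iff.2 ?_ (D.mem_closure_graph x j 1 f h (by simpa using hh))
  rintro _ ⟨f', rfl⟩
  have h1 := D.comm_apply x j S f' g
  rw [hB, hA, ofL2_apply, ofL2_apply, ofL2_apply] at h1
  simp only [mem_ofPred_eq, pow_one]
  rw [h1]
  ring

/-- If `w_j(x, ·)` is bounded by `c` on the support of `f`, then `w_j(x, ·) ^ N A f`, defined by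
duality, belongs to `L²` whenever sufficiently many iterated commutators are bounded. -/
theorem exists_inner_mulOp_pow (D : TestSpace μ w) (x : X) (j : Fin ℓ)
    (hw : AEMeasurable (fun y => w x y j) μ)
    (T : Lp ℂ 2 μ →L[ℂ] Lp ℂ 2 μ) {M B c : ℝ} (hc : 0 ≤ c) (hM : 0 ≤ M) (hB : 0 ≤ B)
    {N₀ : ℕ} (A : ℕ → Lp ℂ 2 μ →L[ℂ] Lp ℂ 2 μ)
    (hA : ∀ k ≤ N₀, D.Ad x j T k = D.ofL2 (A k)) (hAn : ∀ k ≤ N₀, ‖A k‖ ≤ M * B ^ k)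
    (N : ℕ) : ∀ k, k + N ≤ N₀ → ∀ f : Lp ℂ 2 μ, (∀ᵐ y ∂μ, ‖(w x y j : ℂ) * f y‖ ≤ c * ‖f y‖) →
      ∃ h : Lp ℂ 2 μ, ‖h‖ ≤ M * B ^ k * (c + B) ^ N * ‖f‖ ∧ ∀ g : D.carrier,
        inner ℂ ((D.mulOp x j ^ N) g : Lp ℂ 2 μ) (A k f) = inner ℂ (g : Lp ℂ 2 μ) h := by
  induction N with
  | zero =>
    intro k hk f _
    refine ⟨A k f, ?_, fun g => by simp⟩
    simpa using (A k).le_of_opNorm_le (hAn k (by omega)) f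
  | succ N ih =>
    intro k hk f hf
    have hmem : MemLp (fun y => (w x y j : ℂ) * f y) 2 μ :=
      (Lp.memLp f).of_le_mul (hw.complex_ofReal.aestronglyMeasurable.mul
        (Lp.aestronglyMeasurable f)) hf
    have hco := hmem.coeFn_toLp
    have hnorm : ‖hmem.toLp _‖ ≤ c * ‖f‖ := by
      refine Lp.norm_le_mul_norm_of_ae_le_mul ?_
      filter_upwards [hco, hf] with y h1 h2
      rwa [h1]
    -- One factor `w` crosses `A k`: it yields `A (k + 1) f` (factor `B`) or `A k (w f)` (factor
    -- `c`). The support condition is pointwise so that `w f` inherits it.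
    obtain ⟨h₁, hn1, hi1⟩ := ih (k + 1) (by omega) f hf
    obtain ⟨h₂, hn2, hi2⟩ := ih k (by omega) (hmem.toLp _) (by
      filter_upwards [hco, hf] with y h1 h2
      rw [h1, norm_mul]
      calc _ ≤ ‖(w x y j : ℂ)‖ * (c * ‖f y‖) := by gcongr
        _ = c * ‖(w x y j : ℂ) * f y‖ := by rw [norm_mul]; ring)
    refine ⟨h₂ + h₁, ?_, fun g => ?_⟩
    · calc ‖h₂ + h₁‖ ≤ ‖h₂‖ + ‖h₁‖ := norm_add_le _ _
        _ ≤ M * B ^ k * (c + B) ^ N * (c * ‖f‖) + M * B ^ (k + 1) * (c + B) ^ N * ‖f‖ := by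
          refine add_le_add (hn2.trans ?_) hn1
          gcongr
        _ = _ := by ring
    · rw [pow_succ', Module.End.mul_apply,
        D.inner_mulOp_apply x j (hA k (by omega)) (hA (k + 1) (by omega)) f _ hco,
        hi1, hi2, inner_add_right]

/-- Weighted estimate, localized to a set on which the weight is bounded. -/
theorem eLpNorm_indicator_weight_le (D : TestSpace μ w) (x : X) (j : Fin ℓ)
    (hw : AEMeasurable (fun y => w x y j) μ)
    (T : Lp ℂ 2 μ →L[ℂ] Lp ℂ 2 μ) {M B c : ℝ} (hc : 0 ≤ c) (hTM : ‖T‖ ≤ M) (hM : 1 ≤ M)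
    (hB : 0 ≤ B) {N : ℕ}
    (hA : ∀ k, 1 ≤ k → k ≤ N → D.ExtendsWithNormLE (D.Ad x j T k) (B ^ k))
    (f : Lp ℂ 2 μ) (hf : ∀ᵐ y ∂μ, ‖(w x y j : ℂ) * f y‖ ≤ c * ‖f y‖)
    {E : Set X} (hE : MeasurableSet E) {b : ℝ} (hb : ∀ y ∈ E, |w x y j| ≤ b) :
    eLpNorm (E.indicator fun y => (w x y j : ℂ) ^ N * T f y) 2 μ ≤
      ENNReal.ofReal (M * (c + B) ^ N * ‖f‖) := by
  -- As `M ≥ 1`, the single bound `M * B ^ k` covers `T` and its commutators; the value for `k > N`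
  -- is irrelevant.
  have hex : ∀ k, ∃ A : Lp ℂ 2 μ →L[ℂ] Lp ℂ 2 μ, k ≤ N →
      D.Ad x j T k = D.ofL2 A ∧ ‖A‖ ≤ M * B ^ k ∧ (k = 0 → A = T) := by
    intro k
    rcases Nat.eq_zero_or_pos k with rfl | hk
    · exact ⟨T, fun _ => ⟨rfl, by simpa using hTM, fun _ => rfl⟩⟩
    · by_cases hkN : k ≤ N
      · obtain ⟨A, h1, h2⟩ := hA k hk hkN
        exact ⟨A, fun _ => ⟨h1, h2.trans (le_mul_of_one_le_left (by positivity) hM),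
          fun h => by omega⟩⟩
      · exact ⟨0, fun h => absurd h hkN⟩
  choose A hA' using hex
  obtain ⟨h, hn, hi⟩ := D.exists_inner_mulOp_pow x j hw T hc (by linarith) hB A
    (fun k hk => (hA' k hk).1) (fun k hk => (hA' k hk).2.1) N 0 (by omega) f hf
  rw [(hA' 0 (by omega)).2.2 rfl] at hi
  have hwm : AEStronglyMeasurable (fun y => (w x y j : ℂ) ^ N) μ :=
    (hw.complex_ofReal.pow_const N).aestronglyMeasurable
  have hbd : ∀ y ∈ E, ‖(w x y j : ℂ) ^ N‖ ≤ b ^ N := by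
    intro y hy
    rw [norm_pow, Complex.norm_real, Real.norm_eq_abs]
    exact pow_le_pow_left₀ (abs_nonneg _) (hb y hy) N
  have hmem : MemLp (E.indicator fun y => (w x y j : ℂ) ^ N * T f y) 2 μ := by
    refine (Lp.memLp (T f)).of_le_mul (c := |b ^ N|)
      ((hwm.mul (Lp.aestronglyMeasurable _)).indicator hE) (ae_of_all _ fun y => ?_)
    by_cases hy : y ∈ E
    · rw [indicator_of_mem hy, norm_mul]
      gcongr
      exact (hbd y hy).trans (le_abs_self _)
    · rw [indicator_of_notMem hy, norm_zero]
      positivity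
  -- The test vector is the truncated function itself. The bound `b` only places `g` and `w ^ N g`
  -- in `L²`; it does not enter the estimate.
  set g := hmem.toLp _ with hg
  have hgc := hmem.coeFn_toLp
  have hmem2 : MemLp (fun y => (w x y j : ℂ) ^ N * g y) 2 μ := by
    refine (Lp.memLp g).of_le_mul (c := |b ^ N|) (hwm.mul (Lp.aestronglyMeasurable _)) ?_
    filter_upwards [hgc] with y hy
    rw [hg, hy]
    by_cases hyE : y ∈ E
    · rw [norm_mul]
      gcongr
      exact (hbd y hyE).trans (le_abs_self _)
    · simp [indicator_of_notMem hyE]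
  have hkey : inner ℂ (hmem2.toLp _) (T f) = inner ℂ g h := by
    have hcl : IsClosed {q : Lp ℂ 2 μ × Lp ℂ 2 μ | inner ℂ q.2 (T f) = inner ℂ q.1 h} :=
      isClosed_eq (by fun_prop) (by fun_prop)
    refine hcl.closure_subset_iff.2 ?_ (D.mem_closure_graph x j N g _ hmem2.coeFn_toLp)
    rintro _ ⟨g', rfl⟩
    exact hi g'
  -- The weight is real, so `‖g‖² = ⟨w ^ N g, T f⟩ = ⟨g, h⟩`, whence `‖g‖ ≤ ‖h‖`.
  have hself : inner ℂ g g = inner ℂ (hmem2.toLp _) (T f) := by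
    rw [L2.inner_def, L2.inner_def]
    refine integral_congr_ae ?_
    filter_upwards [hgc, hmem2.coeFn_toLp] with y h1 h2
    rw [h2, hg, h1]
    by_cases hyE : y ∈ E
    · simp only [indicator_of_mem hyE, RCLike.inner_apply, map_mul, map_pow, Complex.conj_ofReal]
      ring
    · simp [indicator_of_notMem hyE]
  have hle : ‖g‖ ≤ ‖h‖ := by
    have h1 : ‖g‖ * ‖g‖ ≤ ‖g‖ * ‖h‖ := by
      rw [← inner_self_eq_norm_mul_norm (𝕜 := ℂ) g, inner_self_re_eq_norm, hself, hkey]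
      exact norm_inner_le_norm _ _
    rcases eq_or_lt_of_le (norm_nonneg g) with h0 | h0
    · rw [← h0]; exact norm_nonneg _
    · exact le_of_mul_le_mul_left h1 h0
  rw [← ENNReal.ofReal_toReal hmem.2.ne, ← Lp.norm_toLp _ hmem]
  exact ENNReal.ofReal_le_ofReal (hle.trans (by simpa using hn))

end TestSpace

end Commutators

/-! ### Decay of `T f` away from the support of `f` -/

section Weighted

variable {μ : Measure X} {ℓ : ℕ} {w : X → X → EuclideanSpace ℝ (Fin ℓ)} {K₀ : ℝ}

theorem eLpNorm_two_sq (ν : Measure X) (f : X → ℂ) :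
    eLpNorm f 2 ν ^ 2 = ∫⁻ y, ‖f y‖ₑ ^ 2 ∂ν := by
  have := eLpNorm_nnreal_pow_eq_lintegral (f := f) (μ := ν) (p := 2) two_ne_zero
  simpa using this

theorem ofReal_norm_sq (a : ℂ) : ENNReal.ofReal (‖a‖ ^ 2) = ‖a‖ₑ ^ 2 := by
  rw [ENNReal.ofReal_pow (norm_nonneg _), ofReal_norm]

/-- Power means pass from the Euclidean norm to the components, which the commutators control one at
a time. -/
theorem IsWeight.dist_pow_le (hw : IsWeight μ K₀ w) (hK : 0 < K₀) {N : ℕ} (hN : 1 ≤ N) (x y : X) :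
    dist x y ^ (2 * N) ≤ K₀ ^ (2 * N) * (ℓ : ℝ) ^ N * ∑ j, |w x y j| ^ (2 * N) := by
  obtain ⟨m, rfl⟩ := Nat.exists_eq_add_of_le' hN
  have h1 : dist x y ≤ K₀ * ‖w x y‖ := by
    have := hw.lower x y
    rwa [inv_mul_le_iff₀ hK] at this
  have h2 : (∑ j, |w x y j| ^ 2) ^ (m + 1) ≤ (ℓ : ℝ) ^ (m + 1) * ∑ j, |w x y j| ^ (2 * (m + 1)) := by
    rcases Nat.eq_zero_or_pos ℓ with rfl | hl
    · simp
    have hl' : (1 : ℝ) ≤ ℓ := by exact_mod_cast hl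
    have h3 := pow_sum_div_card_le_sum_pow (s := Finset.univ) (f := fun j => |w x y j| ^ 2)
      (fun j _ => by positivity) m
    rw [div_le_iff₀ (by simp; positivity)] at h3
    simp only [Finset.card_univ, Fintype.card_fin, ← pow_mul] at h3
    refine h3.trans ?_
    rw [mul_comm]
    gcongr
    omega
  calc dist x y ^ (2 * (m + 1)) ≤ (K₀ * ‖w x y‖) ^ (2 * (m + 1)) := by gcongr
    _ = K₀ ^ (2 * (m + 1)) * (∑ j, |w x y j| ^ 2) ^ (m + 1) := by
      rw [mul_pow, pow_mul ‖w x y‖, EuclideanSpace.norm_sq_eq]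
      simp
    _ ≤ K₀ ^ (2 * (m + 1)) * ((ℓ : ℝ) ^ (m + 1) * ∑ j, |w x y j| ^ (2 * (m + 1))) := by gcongr
    _ = _ := by ring

namespace TestSpace

variable [BorelSpace X]

/-- Polynomial decay of `T f` in the mean, for `f` supported in a ball. -/
theorem setLIntegral_dist_pow_le (D : TestSpace μ w) (hw : IsWeight μ K₀ w) (hK : 0 < K₀)
    (T : Lp ℂ 2 μ →L[ℂ] Lp ℂ 2 μ) {M B r : ℝ} (hr : 0 ≤ r) (hTM : ‖T‖ ≤ M) (hM : 1 ≤ M)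
    (hB : 0 ≤ B) {N : ℕ} (hN : 1 ≤ N) (z : X)
    (hA : ∀ k, 1 ≤ k → k ≤ N → ∀ j, D.ExtendsWithNormLE (D.Ad z j T k) (B ^ k))
    (f : Lp ℂ 2 μ) (hf : ∀ᵐ y ∂μ, y ∉ ball z r → f y = 0)
    {E : Set X} (hE : MeasurableSet E) {r' : ℝ} (hEr : E ⊆ ball z r') :
    ∫⁻ y in E, ENNReal.ofReal (dist z y ^ (2 * N) * ‖T f y‖ ^ 2) ∂μ ≤
      ENNReal.ofReal (K₀ ^ (2 * N) * (ℓ : ℝ) ^ (N + 1) *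
        (M * (K₀ * r + B) ^ N * ‖f‖) ^ 2) := by
  have hwle : ∀ y j, |w z y j| ≤ K₀ * dist z y := by
    intro y j
    have := PiLp.norm_apply_le (w z y) j
    rw [Real.norm_eq_abs] at this
    exact this.trans (hw.upper z y)
  have hj : ∀ j, ∫⁻ y in E, ENNReal.ofReal (|w z y j| ^ (2 * N) * ‖T f y‖ ^ 2) ∂μ ≤
      ENNReal.ofReal ((M * (K₀ * r + B) ^ N * ‖f‖) ^ 2) := by
    intro j
    have h1 := D.eLpNorm_indicator_weight_le z j (hw.aemeasurable z j) T (c := K₀ * r)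
      (by positivity) hTM hM hB (fun k h1 h2 => hA k h1 h2 j) f (by
        filter_upwards [hf] with y hy
        by_cases hyb : y ∈ ball z r
        · rw [norm_mul, Complex.norm_real, Real.norm_eq_abs]
          gcongr
          refine (hwle y j).trans ?_
          rw [mem_ball'] at hyb
          gcongr
        · simp [hy hyb]) hE (b := K₀ * r') (by
        intro y hy
        refine (hwle y j).trans ?_
        have := hEr hy
        rw [mem_ball'] at this
        gcongr)
    have h2 := pow_le_pow_left' h1 2
    rw [eLpNorm_indicator_eq_eLpNorm_restrict hE, eLpNorm_two_sq,
      ← ENNReal.ofReal_pow (by positivity)] at h2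
    refine le_of_eq_of_le (lintegral_congr fun y => ?_) h2
    rw [← ofReal_norm_sq, norm_mul, norm_pow, Complex.norm_real, Real.norm_eq_abs, mul_pow,
      ← pow_mul, mul_comm N]
  calc ∫⁻ y in E, ENNReal.ofReal (dist z y ^ (2 * N) * ‖T f y‖ ^ 2) ∂μ
      ≤ ∫⁻ y in E, ENNReal.ofReal (K₀ ^ (2 * N) * (ℓ : ℝ) ^ N) *
          ∑ j, ENNReal.ofReal (|w z y j| ^ (2 * N) * ‖T f y‖ ^ 2) ∂μ := by
        refine lintegral_mono fun y => ?_
        rw [← ENNReal.ofReal_sum_of_nonneg (fun _ _ => by positivity),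
          ← ENNReal.ofReal_mul (by positivity), ← Finset.sum_mul, ← mul_assoc]
        refine ENNReal.ofReal_le_ofReal ?_
        gcongr
        exact hw.dist_pow_le hK hN z y
    _ = ENNReal.ofReal (K₀ ^ (2 * N) * (ℓ : ℝ) ^ N) *
          ∑ j, ∫⁻ y in E, ENNReal.ofReal (|w z y j| ^ (2 * N) * ‖T f y‖ ^ 2) ∂μ := by
        rw [lintegral_const_mul' _ _ ENNReal.ofReal_ne_top, lintegral_finsetSum']
        intro j _
        have h1 := (hw.aemeasurable z j).restrict (s := E)
        have h2 := (Lp.aestronglyMeasurable (T f)).aemeasurable.restrict (s := E)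
        exact ((h1.abs.pow_const _).mul (h2.norm.pow_const _)).ennreal_ofReal
    _ ≤ ENNReal.ofReal (K₀ ^ (2 * N) * (ℓ : ℝ) ^ N) *
          ∑ _j : Fin ℓ, ENNReal.ofReal ((M * (K₀ * r + B) ^ N * ‖f‖) ^ 2) := by
        gcongr with j
        exact hj j
    _ = _ := by
        rw [Finset.sum_const, Finset.card_univ, Fintype.card_fin, nsmul_eq_mul,
          ← ENNReal.ofReal_natCast, ← ENNReal.ofReal_mul (by positivity),
          ← ENNReal.ofReal_mul (by positivity)]
        congr 1
        ring

/-- On `R i` the distances from `z` to `x i` and to `y` differ by at most `r`, so the sum is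
controlled by one integral over the disjoint union. Measuring distance in units of `B` absorbs `(K₀
r + B) ^ N ≤ (K₀ r + 1) ^ N B ^ N`: the bound is free of `B`. -/
theorem sum_weight_mul_eLpNorm_sq_le (D : TestSpace μ w) (hw : IsWeight μ K₀ w) (hK : 0 < K₀)
    (T : Lp ℂ 2 μ →L[ℂ] Lp ℂ 2 μ) {M B r : ℝ} (hr : 0 ≤ r) (hTM : ‖T‖ ≤ M) (hM : 1 ≤ M)
    (hB : 1 ≤ B) {N : ℕ} (hN : 1 ≤ N) (z : X)
    (hA : ∀ k, 1 ≤ k → k ≤ N → ∀ j, D.ExtendsWithNormLE (D.Ad z j T k) (B ^ k))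
    (f : Lp ℂ 2 μ) (hf : ∀ᵐ y ∂μ, y ∉ ball z r → f y = 0)
    {ι : Type*} (S : Finset ι) (R : ι → Set X) (x : ι → X) (hRm : ∀ i, MeasurableSet (R i))
    (hRd : Pairwise (Function.onFun Disjoint R)) (hRx : ∀ i, R i ⊆ ball (x i) r) :
    ∑ i ∈ S, ENNReal.ofReal ((1 + dist z (x i) / B) ^ (2 * N)) *
        eLpNorm (T f) 2 (μ.restrict (R i)) ^ 2 ≤
      ENNReal.ofReal (2 ^ (2 * N) * ((1 + r) ^ (2 * N) + K₀ ^ (2 * N) * (ℓ : ℝ) ^ (N + 1) *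
        (K₀ * r + 1) ^ (2 * N)) * M ^ 2 * ‖f‖ ^ 2) := by
  have hB0 : 0 < B := by linarith
  have hM0 : 0 < M := by linarith
  set E := ⋃ i ∈ S, R i with hE
  have hEm : MeasurableSet E := S.measurableSet_biUnion fun i _ => hRm i
  -- Finiteness of `S` makes `E` bounded; `r'` appears in no estimate.
  have hEb : ∃ r', E ⊆ ball z r' := by
    have : Bornology.IsBounded E :=
      (Bornology.isBounded_biUnion_finset S).2 fun i _ => isBounded_ball.subset (hRx i)
    exact this.subset_ball z
  obtain ⟨r', hr'⟩ := hEb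
  have hmeas : AEMeasurable (fun y => ENNReal.ofReal ((1 + r) ^ (2 * N) * ‖T f y‖ ^ 2))
      (μ.restrict E) :=
    ((Lp.aestronglyMeasurable (T f)).aemeasurable.restrict.norm.pow_const 2).const_mul _
      |>.ennreal_ofReal
  have hTf : ∫⁻ y in E, ENNReal.ofReal ((1 + r) ^ (2 * N) * ‖T f y‖ ^ 2) ∂μ ≤
      ENNReal.ofReal ((1 + r) ^ (2 * N) * (M * ‖f‖) ^ 2) := by
    simp only [ENNReal.ofReal_mul (show 0 ≤ (1 + r) ^ (2 * N) by positivity)]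
    rw [lintegral_const_mul' _ _ ENNReal.ofReal_ne_top]
    gcongr
    simp only [ofReal_norm_sq]
    refine (setLIntegral_le_lintegral _ _).trans ?_
    rw [← eLpNorm_two_sq, ENNReal.ofReal_pow (by positivity)]
    gcongr
    rw [← ENNReal.ofReal_toReal (Lp.eLpNorm_ne_top (T f)), ← Lp.norm_def]
    exact ENNReal.ofReal_le_ofReal (T.le_of_opNorm_le hTM f)
  calc ∑ i ∈ S, ENNReal.ofReal ((1 + dist z (x i) / B) ^ (2 * N)) *
        eLpNorm (T f) 2 (μ.restrict (R i)) ^ 2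
      ≤ ∑ i ∈ S, ∫⁻ y in R i, ENNReal.ofReal (2 ^ (2 * N)) *
          (ENNReal.ofReal ((1 + r) ^ (2 * N) * ‖T f y‖ ^ 2) + ENNReal.ofReal ((B ^ (2 * N))⁻¹) *
            ENNReal.ofReal (dist z y ^ (2 * N) * ‖T f y‖ ^ 2)) ∂μ := by
        refine Finset.sum_le_sum fun i _ => ?_
        rw [eLpNorm_two_sq, ← lintegral_const_mul' _ _ ENNReal.ofReal_ne_top]
        refine setLIntegral_mono_ae' (hRm i) (ae_of_all _ fun y hy => ?_)
        rw [← ofReal_norm_sq, ← ENNReal.ofReal_mul (by positivity),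
          ← ENNReal.ofReal_mul (by positivity), ← ENNReal.ofReal_add (by positivity)
          (by positivity), ← ENNReal.ofReal_mul (by positivity)]
        refine ENNReal.ofReal_le_ofReal ?_
        have hd : dist z (x i) ≤ r + dist z y := by
          have h1 := mem_ball.1 (hRx i hy)
          have h2 := dist_triangle z y (x i)
          linarith
        have h3 : 1 + dist z (x i) / B ≤ (1 + r) + dist z y / B := by
          have : dist z (x i) / B ≤ r + dist z y / B := by
            rw [div_le_iff₀ hB0, add_mul, div_mul_cancel₀ _ hB0.ne']
            nlinarith
          linarith
        have h4 : (1 + dist z (x i) / B) ^ (2 * N) ≤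
            2 ^ (2 * N) * ((1 + r) ^ (2 * N) + (dist z y / B) ^ (2 * N)) := by
          calc _ ≤ ((1 + r) + dist z y / B) ^ (2 * N) := by gcongr
            _ ≤ 2 ^ (2 * N - 1) * ((1 + r) ^ (2 * N) + (dist z y / B) ^ (2 * N)) :=
              add_pow_le (by positivity) (by positivity) _
            _ ≤ _ := by
              gcongr
              · norm_num
              · omega
        calc _ ≤ 2 ^ (2 * N) * ((1 + r) ^ (2 * N) + (dist z y / B) ^ (2 * N)) * ‖T f y‖ ^ 2 := by
              gcongr
          _ = _ := by rw [div_pow]; ring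
    _ = ∫⁻ y in E, ENNReal.ofReal (2 ^ (2 * N)) *
          (ENNReal.ofReal ((1 + r) ^ (2 * N) * ‖T f y‖ ^ 2) + ENNReal.ofReal ((B ^ (2 * N))⁻¹) *
            ENNReal.ofReal (dist z y ^ (2 * N) * ‖T f y‖ ^ 2)) ∂μ := by
        rw [hE, lintegral_biUnion_finset (fun i _ j _ hij => hRd hij) (fun i _ => hRm i)]
    _ = ENNReal.ofReal (2 ^ (2 * N)) *
          (∫⁻ y in E, ENNReal.ofReal ((1 + r) ^ (2 * N) * ‖T f y‖ ^ 2) ∂μ +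
          ENNReal.ofReal ((B ^ (2 * N))⁻¹) *
          ∫⁻ y in E, ENNReal.ofReal (dist z y ^ (2 * N) * ‖T f y‖ ^ 2) ∂μ) := by
        rw [lintegral_const_mul' _ _ ENNReal.ofReal_ne_top, lintegral_add_left' hmeas,
          lintegral_const_mul' _ _ ENNReal.ofReal_ne_top]
    _ ≤ ENNReal.ofReal (2 ^ (2 * N)) * (ENNReal.ofReal ((1 + r) ^ (2 * N) * (M * ‖f‖) ^ 2) +
          ENNReal.ofReal ((B ^ (2 * N))⁻¹) * ENNReal.ofReal (K₀ ^ (2 * N) * (ℓ : ℝ) ^ (N + 1) *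
        (M * (K₀ * r + B) ^ N * ‖f‖) ^ 2)) := by
        gcongr
        exact D.setLIntegral_dist_pow_le hw hK T hr hTM hM hB0.le hN z hA f hf hEm hr'
    _ ≤ _ := by
        rw [← ENNReal.ofReal_mul (by positivity), ← ENNReal.ofReal_add (by positivity)
          (by positivity), ← ENNReal.ofReal_mul (by positivity)]
        refine ENNReal.ofReal_le_ofReal ?_
        have h5 : (K₀ * r + B) ^ N ≤ (K₀ * r + 1) ^ N * B ^ N := by
          rw [← mul_pow]
          gcongr
          nlinarith [mul_nonneg (mul_nonneg hK.le hr) (sub_nonneg.2 hB)]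
        calc _ ≤ 2 ^ (2 * N) * ((1 + r) ^ (2 * N) * (M * ‖f‖) ^ 2 + (B ^ (2 * N))⁻¹ *
              (K₀ ^ (2 * N) * (ℓ : ℝ) ^ (N + 1) *
                (M * ((K₀ * r + 1) ^ N * B ^ N) * ‖f‖) ^ 2)) := by gcongr
          _ = 2 ^ (2 * N) * ((1 + r) ^ (2 * N) * (M * ‖f‖) ^ 2 + (B ^ (2 * N))⁻¹ * B ^ (2 * N) *
              (K₀ ^ (2 * N) * (ℓ : ℝ) ^ (N + 1) *
                (M * (K₀ * r + 1) ^ N * ‖f‖) ^ 2)) := by ring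
          _ = _ := by
            rw [inv_mul_cancel₀ (by positivity)]
            ring

end TestSpace

end Weighted

/-! ### Counting separated points in a doubling space -/

section Counting

variable {μ : Measure X} {n Cd : ℝ}

/-- By doubling, the dilates of a null ball are null, and they exhaust the space. -/
theorem IsDoubling.measure_ball_pos (h : IsDoubling μ n Cd) (hμ : μ ≠ 0) (x : X) {r : ℝ}
    (hr : 0 < r) : 0 < μ (ball x r) := by
  rw [pos_iff_ne_zero]
  intro h0
  refine hμ (Measure.measure_univ_eq_zero.1 ?_)
  have hU : (univ : Set X) ⊆ ⋃ k : ℕ, ball x ((k + 1 : ℝ) * r) := by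
    intro y _
    obtain ⟨k, hk⟩ := exists_nat_gt (dist y x / r)
    rw [div_lt_iff₀ hr] at hk
    refine mem_iUnion.2 ⟨k, mem_ball.2 (hk.trans_le ?_)⟩
    gcongr
    linarith
  refine measure_mono_null hU (measure_iUnion_null fun k => ?_)
  have := h.ball_le x r hr (k + 1) (by simp)
  rwa [h0, mul_zero, nonpos_iff_eq_zero] at this

/-- In a doubling space, the number of disjoint balls of radius `c` with centers in a ball of
radius `r` is controlled. -/
theorem IsDoubling.card_le [BorelSpace X] (h : IsDoubling μ n Cd) (hμ : μ ≠ 0) {ι : Type*} {x : ι → X}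
    {c r : ℝ} (hc : 0 < c) (hd : Pairwise (Function.onFun Disjoint fun i => ball (x i) c))
    (hr : 0 ≤ r) (z : X) (S : Finset ι) (hS : ∀ i ∈ S, dist z (x i) < r) :
    (S.card : ℝ≥0∞) ≤ ENNReal.ofReal (Cd * (1 + 2 * r / c) ^ n) := by
  have hpos : 0 < μ (ball z (r + c)) := h.measure_ball_pos hμ z (by positivity)
  -- Volume comparison: `ball z (r + c)` contains the disjoint small balls, and each of these
  -- dilated by `1 + 2 * r / c` contains it.
  rw [← ENNReal.mul_le_mul_iff_left hpos.ne' (h.finite_ball z (r + c)).ne]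
  calc (S.card : ℝ≥0∞) * μ (ball z (r + c)) = ∑ i ∈ S, μ (ball z (r + c)) := by
        rw [Finset.sum_const, nsmul_eq_mul]
    _ ≤ ∑ i ∈ S, ENNReal.ofReal (Cd * (1 + 2 * r / c) ^ n) * μ (ball (x i) c) := by
        refine Finset.sum_le_sum fun i hi => ?_
        refine le_trans (measure_mono ?_) (h.ball_le (x i) c hc (1 + 2 * r / c)
          (by simp; positivity))
        refine ball_subset_ball' ?_
        rw [add_mul, div_mul_cancel₀ _ hc.ne']
        linarith [hS i hi]
    _ = ENNReal.ofReal (Cd * (1 + 2 * r / c) ^ n) * μ (⋃ i ∈ S, ball (x i) c) := by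
        rw [← Finset.mul_sum, measure_biUnion_finset (fun i _ j _ hij => hd hij)
          fun i _ => measurableSet_ball]
    _ ≤ _ := by
        gcongr
        refine iUnion₂_subset fun i hi => ball_subset_ball' ?_
        have := hS i hi
        rw [dist_comm] at this
        linarith

theorem IsDoubling.countable [BorelSpace X] (h : IsDoubling μ n Cd) (hμ : μ ≠ 0) {ι : Type*}
    {x : ι → X} {c : ℝ} (hc : 0 < c)
    (hd : Pairwise (Function.onFun Disjoint fun i => ball (x i) c)) : Countable ι := by
  rcases isEmpty_or_nonempty ι with hι | ⟨⟨i₀⟩⟩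
  · infer_instance
  have hU : (univ : Set ι) = ⋃ k : ℕ, {i | dist (x i₀) (x i) < k} := by
    ext i
    simpa using exists_nat_gt (dist (x i₀) (x i))
  rw [← Set.countable_univ_iff, hU]
  refine countable_iUnion fun k => Set.Finite.countable ?_
  by_contra hinf
  obtain ⟨m, hm⟩ := exists_nat_gt (Cd * (1 + 2 * (k : ℝ) / c) ^ n)
  obtain ⟨S, hS, hcard⟩ := Set.Infinite.exists_subset_card_eq hinf (m + 1)
  have := h.card_le hμ hc hd (Nat.cast_nonneg k) (x i₀) S (fun i hi => hS hi)
  rw [hcard] at this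
  have h2 : ENNReal.ofReal (Cd * (1 + 2 * (k : ℝ) / c) ^ n) ≤ (m : ℕ) := by
    rw [← ENNReal.ofReal_natCast]
    exact ENNReal.ofReal_le_ofReal hm.le
  have h3 := this.trans h2
  rw [Nat.cast_le] at h3
  omega

/-- The least `k` with `t < 2 ^ k` has `2 ^ k ≤ 2 (1 + t)`, so its term suffices. Conditions `t < 2
^ k` turn into counts of points in balls. -/
theorem one_add_pow_inv_le_tsum (N : ℕ) {t : ℝ} (ht : 0 ≤ t) :
    ENNReal.ofReal ((1 + t) ^ (2 * N))⁻¹ ≤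
      ∑' k : ℕ, if t < 2 ^ k then ENNReal.ofReal (2 ^ (2 * N) * ((2 ^ k) ^ (2 * N))⁻¹) else 0 := by
  classical
  have hex : ∃ k : ℕ, t < 2 ^ k := pow_unbounded_of_one_lt t (by norm_num)
  refine le_trans ?_ (ENNReal.le_tsum (Nat.find hex))
  rw [if_pos (Nat.find_spec hex)]
  refine ENNReal.ofReal_le_ofReal ?_
  rw [← div_eq_mul_inv, ← div_pow, ← inv_pow]
  refine pow_le_pow_left₀ (by positivity) ?_ _
  rw [inv_le_comm₀ (by positivity) (by positivity), inv_div, div_le_iff₀ (by norm_num)]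
  rcases Nat.eq_zero_or_pos (Nat.find hex) with h0 | h0
  · rw [h0]
    linarith
  · obtain ⟨m, hm⟩ := Nat.exists_eq_succ_of_ne_zero h0.ne'
    have := Nat.find_min hex (m := m) (by omega)
    rw [hm, pow_succ]
    linarith

/-- At scale `2 ^ k B` there are `O((2 ^ k B) ^ n)` points of weight about `2 ^ (-2Nk)`: a geometric
series of ratio `2 ^ (n - 2N) < 1`. -/
theorem IsDoubling.sum_kernel_le [BorelSpace X] (h : IsDoubling μ n Cd) (hμ : μ ≠ 0) (hn : 0 < n)
    (hCd : 0 ≤ Cd) {ι : Type*}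
    {x : ι → X} {c : ℝ} (hc : 0 < c)
    (hd : Pairwise (Function.onFun Disjoint fun i => ball (x i) c)) {N : ℕ} (hN : n < 2 * N)
    {B : ℝ} (hB : 1 ≤ B) (z : X) (S : Finset ι) :
    ∑ i ∈ S, ((1 + dist z (x i) / B) ^ (2 * N))⁻¹ ≤
      2 ^ (2 * N) * Cd * (1 + 2 / c) ^ n * (1 - (2 : ℝ) ^ (n - 2 * N))⁻¹ * B ^ n := by
  classical
  have hB0 : 0 < B := by linarith
  have hq : (2 : ℝ) ^ (n - 2 * N) < 1 :=
    Real.rpow_lt_one_of_one_lt_of_neg (by norm_num) (by linarith)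
  have hq0 : (0 : ℝ) < 2 ^ (n - 2 * N) := by positivity
  have hq1 : 0 < 1 - (2 : ℝ) ^ (n - 2 * N) := by linarith
  rw [← ENNReal.ofReal_le_ofReal_iff (by positivity),
    ENNReal.ofReal_sum_of_nonneg (fun _ _ => by positivity)]
  calc ∑ i ∈ S, ENNReal.ofReal ((1 + dist z (x i) / B) ^ (2 * N))⁻¹
      ≤ ∑ i ∈ S, ∑' k : ℕ, if dist z (x i) / B < 2 ^ k then
          ENNReal.ofReal (2 ^ (2 * N) * ((2 ^ k) ^ (2 * N))⁻¹) else 0 :=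
        Finset.sum_le_sum fun i _ => one_add_pow_inv_le_tsum N (by positivity)
    _ = ∑' k : ℕ, ∑ i ∈ S, if dist z (x i) / B < 2 ^ k then
          ENNReal.ofReal (2 ^ (2 * N) * ((2 ^ k) ^ (2 * N))⁻¹) else 0 :=
        (Summable.tsum_finsetSum fun _ _ => ENNReal.summable).symm
    _ ≤ ∑' k : ℕ, ENNReal.ofReal (2 ^ (2 * N) * Cd * (1 + 2 / c) ^ n * B ^ n *
          (2 ^ (n - 2 * N)) ^ k) := by
        refine ENNReal.tsum_le_tsum fun k => ?_
        rw [← Finset.sum_filter, Finset.sum_const, nsmul_eq_mul]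
        have h1 := h.card_le hμ hc hd (r := 2 ^ k * B) (by positivity) z
          {i ∈ S | dist z (x i) / B < 2 ^ k} (by
            intro i hi
            exact (div_lt_iff₀ hB0).1 (Finset.mem_filter.1 hi).2)
        refine (mul_le_mul_left h1 _).trans ?_
        rw [← ENNReal.ofReal_mul (by positivity)]
        refine ENNReal.ofReal_le_ofReal ?_
        have hk1 : (1 : ℝ) ≤ 2 ^ k := one_le_pow₀ (by norm_num)
        have h2 : (1 + 2 * (2 ^ k * B) / c) ^ n ≤ (1 + 2 / c) ^ n * B ^ n * (2 ^ n) ^ k := by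
          rw [Real.rpow_pow_comm (by norm_num), ← Real.mul_rpow (by positivity) (by positivity),
            ← Real.mul_rpow (by positivity) (by positivity)]
          refine Real.rpow_le_rpow (by positivity) ?_ hn.le
          have : 1 ≤ 2 ^ k * B := one_le_mul_of_one_le_of_one_le hk1 hB
          calc 1 + 2 * (2 ^ k * B) / c ≤ 2 ^ k * B + 2 * (2 ^ k * B) / c := by gcongr
            _ = _ := by ring
        have h3 : ((2 : ℝ) ^ (n - 2 * N)) ^ k = (2 ^ n) ^ k * ((2 ^ k) ^ (2 * N))⁻¹ := by
          rw [Real.rpow_sub (by norm_num), div_pow, div_eq_mul_inv]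
          congr 2
          rw [show (2 * N : ℝ) = ((2 * N : ℕ) : ℝ) by push_cast; rfl, Real.rpow_natCast,
            ← pow_mul, ← pow_mul, mul_comm]
        rw [h3]
        calc _ ≤ Cd * ((1 + 2 / c) ^ n * B ^ n * (2 ^ n) ^ k) *
              (2 ^ (2 * N) * ((2 ^ k) ^ (2 * N))⁻¹) := by gcongr
          _ = _ := by ring
    _ = _ := by
        rw [← ENNReal.ofReal_tsum_of_nonneg (fun k => by positivity)
          ((summable_geometric_of_lt_one hq0.le hq).mul_left _), tsum_mul_left,
          tsum_geometric_of_lt_one hq0.le hq]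
        congr 1
        ring

end Counting

/-! ### Cubes and the endpoint `p = 1` -/

section Cubes

variable {μ : Measure X} {c₀ C₀ : ℝ} (𝒬 : DyadicCubes μ c₀ C₀)

namespace DyadicCubes

theorem exists_center : ∃ x : 𝒬.cubes 0 → X, ∀ Q, ball (x Q) c₀ ⊆ Q ∧ (Q : Set X) ⊆ ball (x Q) C₀ := by
  have : ∀ Q : 𝒬.cubes 0, ∃ x, ball x c₀ ⊆ Q ∧ (Q : Set X) ⊆ ball x C₀ := by
    intro Q
    simpa using 𝒬.center 0 Q Q.2
  choose x hx using this
  exact ⟨x, hx⟩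

theorem pairwise_disjoint (k : ℤ) :
    Pairwise (Function.onFun Disjoint fun Q : 𝒬.cubes k => (Q : Set X)) := by
  intro Q R hQR
  by_contra h
  have h1 := (𝒬.nested k k le_rfl Q Q.2 R R.2).resolve_right h
  have h2 := (𝒬.nested k k le_rfl R R.2 Q Q.2).resolve_right fun h' => h h'.symm
  exact hQR (Subtype.ext (h1.antisymm h2))

theorem measurableSet [BorelSpace X] (k : ℤ) (Q : 𝒬.cubes k) : MeasurableSet (Q : Set X) :=
  (𝒬.isOpen k Q Q.2).measurableSet

end DyadicCubes

/-- The estimate in `X^{1,2}` for functions supported in a ball. -/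
theorem TestSpace.sum_eLpNorm_le [BorelSpace X] {ℓ : ℕ} {w : X → X → EuclideanSpace ℝ (Fin ℓ)} {K₀ : ℝ}
    (D : TestSpace μ w) (hw : IsWeight μ K₀ w) (hK : 0 < K₀) {n Cd : ℝ} (hn : 0 < n) (hCd : 0 ≤ Cd)
    (h : IsDoubling μ n Cd) (hμ : μ ≠ 0)
    (T : Lp ℂ 2 μ →L[ℂ] Lp ℂ 2 μ) {M B : ℝ} (hTM : ‖T‖ ≤ M) (hM : 1 ≤ M)
    (hB : 1 ≤ B) {N : ℕ} (hN : n < 2 * N) (z : X)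
    (hA : ∀ k, 1 ≤ k → k ≤ N → ∀ j, D.ExtendsWithNormLE (D.Ad z j T k) (B ^ k))
    {r c : ℝ} (hr : 0 ≤ r) (hc : 0 < c)
    (f : Lp ℂ 2 μ) (hf : ∀ᵐ y ∂μ, y ∉ ball z r → f y = 0)
    {ι : Type*} (S : Finset ι) (R : ι → Set X) (x : ι → X) (hRm : ∀ i, MeasurableSet (R i))
    (hRd : Pairwise (Function.onFun Disjoint R)) (hxR : ∀ i, ball (x i) c ⊆ R i)
    (hRx : ∀ i, R i ⊆ ball (x i) r) :
    ∑ i ∈ S, (eLpNorm (T f) 2 (μ.restrict (R i))).toReal ≤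
      √(2 ^ (2 * N) * ((1 + r) ^ (2 * N) + K₀ ^ (2 * N) * (ℓ : ℝ) ^ (N + 1) *
        (K₀ * r + 1) ^ (2 * N)) * M ^ 2 *
        (2 ^ (2 * N) * Cd * (1 + 2 / c) ^ n * (1 - (2 : ℝ) ^ (n - 2 * N))⁻¹)) *
        B ^ (n / 2) * ‖f‖ := by
  have hB0 : 0 < B := by linarith
  have hN1 : 1 ≤ N := by
    by_contra h0
    have : N = 0 := by omega
    subst this
    simp at hN
    linarith
  have hfin : ∀ i, eLpNorm (T f) 2 (μ.restrict (R i)) ≠ ∞ := fun i =>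
    ((eLpNorm_mono_measure _ Measure.restrict_le_self).trans_lt (Lp.eLpNorm_lt_top (T f))).ne
  have h1 := D.sum_weight_mul_eLpNorm_sq_le hw hK T hr hTM hM hB hN1 z hA f hf S R x hRm hRd hRx
  have h2 := h.sum_kernel_le hμ hn hCd hc (x := x)
    (fun i j hij => (hRd hij).mono (hxR i) (hxR j)) hN hB z S
  have h3 : ∑ i ∈ S, (1 + dist z (x i) / B) ^ (2 * N) *
      (eLpNorm (T f) 2 (μ.restrict (R i))).toReal ^ 2 ≤
      2 ^ (2 * N) * ((1 + r) ^ (2 * N) + K₀ ^ (2 * N) * (ℓ : ℝ) ^ (N + 1) *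
        (K₀ * r + 1) ^ (2 * N)) * M ^ 2 * ‖f‖ ^ 2 := by
    rw [← ENNReal.ofReal_le_ofReal_iff (by positivity),
      ENNReal.ofReal_sum_of_nonneg (fun _ _ => by positivity)]
    refine le_of_eq_of_le (Finset.sum_congr rfl fun i _ => ?_) h1
    rw [ENNReal.ofReal_mul (by positivity), ENNReal.ofReal_pow ENNReal.toReal_nonneg,
      ENNReal.ofReal_toReal (hfin i)]
  -- Cauchy–Schwarz with the weight and its inverse: the first sum is bounded independently of `B`,
  -- the second is `O(B ^ n)`, whence `B ^ (n / 2)`.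
  have h4 := Finset.sum_sq_le_sum_mul_sum_of_sq_le_mul S
    (r := fun i => (eLpNorm (T f) 2 (μ.restrict (R i))).toReal)
    (f := fun i => (1 + dist z (x i) / B) ^ (2 * N) *
      (eLpNorm (T f) 2 (μ.restrict (R i))).toReal ^ 2)
    (g := fun i => ((1 + dist z (x i) / B) ^ (2 * N))⁻¹)
    (fun i _ => by positivity) (fun i _ => by positivity) (fun i _ => le_of_eq <| by
      have : (1 + dist z (x i) / B) ^ (2 * N) ≠ 0 := by positivity
      field_simp)
  have hq : (2 : ℝ) ^ (n - 2 * N) < 1 :=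
    Real.rpow_lt_one_of_one_lt_of_neg (by norm_num) (by linarith)
  have hq1 : 0 < 1 - (2 : ℝ) ^ (n - 2 * N) := by linarith
  refine (pow_le_pow_iff_left₀ (Finset.sum_nonneg fun i _ => by positivity) (by positivity)
    two_ne_zero).1 ?_
  refine h4.trans ((mul_le_mul h3 h2 (Finset.sum_nonneg fun i _ => by positivity)
    (by positivity)).trans (le_of_eq ?_))
  rw [mul_pow, mul_pow, Real.sq_sqrt (by positivity), ← Real.rpow_natCast (B ^ (n / 2)),
    ← Real.rpow_mul hB0.le]
  norm_num
  ring

end Cubes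

/-! ### Riesz–Thorin for finite matrices and orthogonal families -/

section Interpolation

variable {ι κ : Type*}

theorem rpow_le_one_add {a s : ℝ} (ha : 0 < a) (hs0 : 0 ≤ s) (hs1 : s ≤ 1) : a ^ s ≤ 1 + a := by
  rcases le_total a 1 with h | h
  · linarith [Real.rpow_le_one ha.le h hs0]
  · have := Real.rpow_le_rpow_of_exponent_le h hs1
    rw [Real.rpow_one] at this
    linarith

/-- Riesz–Thorin interpolation between `ℓ¹` and `ℓ²` for a finite matrix. -/
theorem norm_bilin_le_of_column_of_l2 [Fintype ι] [Fintype κ] (m : κ → ι → ℂ) (a : ι → ℝ)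
    (b : κ → ℝ) (ha : ∀ i, 0 < a i) (hb : ∀ k, 0 < b k) {A₁ A₂ : ℝ}
    (h₁ : ∀ i, ∑ k, ‖m k i‖ ≤ A₁)
    (h₂ : ∀ (u : κ → ℂ) (v : ι → ℂ), ‖∑ k, ∑ i, u k * m k i * v i‖ ≤
      A₂ * √(∑ k, ‖u k‖ ^ 2) * √(∑ i, ‖v i‖ ^ 2)) {θ : ℝ} (hθ0 : 0 ≤ θ) (hθ1 : θ ≤ 1) :
    ‖∑ k, ∑ i, ((b k ^ (θ / 2) : ℝ) : ℂ) * m k i * ((a i ^ (1 - θ / 2) : ℝ) : ℂ)‖ ≤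
      (A₁ * ∑ i, a i) ^ (1 - θ) * (A₂ * √(∑ k, b k) * √(∑ i, a i)) ^ θ := by
  -- On `Re z = 0` the moduli of the powers are `1` and `a i`, so the column bound applies; on `Re z
  -- = 1` they are square roots, so the `ℓ²` bound applies. Positivity of `a`, `b` makes `F` entire.
  set F : ℂ → ℂ := fun z => ∑ k, ∑ i, (b k : ℂ) ^ (z / 2) * m k i * (a i : ℂ) ^ (1 - z / 2) with hF
  have hdiff : Differentiable ℂ F := by
    refine Differentiable.fun_sum fun k _ => Differentiable.fun_sum fun i _ => ?_
    have hbk : (b k : ℂ) ≠ 0 := by exact_mod_cast (hb k).ne'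
    have hai : (a i : ℂ) ≠ 0 := by exact_mod_cast (ha i).ne'
    exact (((by fun_prop : Differentiable ℂ fun z : ℂ => z / 2).const_cpow (Or.inl hbk)).mul_const
      _).mul ((by fun_prop : Differentiable ℂ fun z : ℂ => 1 - z / 2).const_cpow (Or.inl hai))
  have hnb : ∀ k (z : ℂ), ‖(b k : ℂ) ^ (z / 2)‖ = b k ^ (z.re / 2) := by
    intro k z
    rw [Complex.norm_cpow_eq_rpow_re_of_pos (hb k)]
    simp
  have hna : ∀ i (z : ℂ), ‖(a i : ℂ) ^ (1 - z / 2)‖ = a i ^ (1 - z.re / 2) := by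
    intro k z
    rw [Complex.norm_cpow_eq_rpow_re_of_pos (ha k)]
    simp
  have hFn : ∀ z, ‖F z‖ ≤ ∑ i, (∑ k, b k ^ (z.re / 2) * ‖m k i‖) * a i ^ (1 - z.re / 2) := by
    intro z
    simp only [hF]
    rw [Finset.sum_comm]
    refine (norm_sum_le _ _).trans (Finset.sum_le_sum fun i _ => (norm_sum_le _ _).trans ?_)
    rw [Finset.sum_mul]
    refine Finset.sum_le_sum fun k _ => ?_
    rw [norm_mul, norm_mul, hnb, hna]
  have h := Complex.HadamardThreeLines.norm_le_interp_of_mem_verticalClosedStrip' (f := F)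
    (z := (θ : ℂ)) (a := A₁ * ∑ i, a i) (b := A₂ * √(∑ k, b k) * √(∑ i, a i)) (l := 0) (u := 1)
    zero_lt_one (by simp [Complex.HadamardThreeLines.verticalClosedStrip, hθ0, hθ1])
    hdiff.diffContOnCl ?_ ?_ ?_
  · simp only [Complex.ofReal_re, sub_zero, div_one] at h
    refine le_of_eq_of_le ?_ h
    rw [hF]
    congr 1
    refine Finset.sum_congr rfl fun k _ => Finset.sum_congr rfl fun i _ => ?_
    rw [Complex.ofReal_cpow (hb k).le, Complex.ofReal_cpow (ha i).le]
    simp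
  · refine ⟨∑ i, (∑ k, (1 + b k) * ‖m k i‖) * (1 + a i), ?_⟩
    rintro _ ⟨z, hz, rfl⟩
    have hz' : 0 ≤ z.re ∧ z.re ≤ 1 := by
      simpa [Complex.HadamardThreeLines.verticalClosedStrip] using hz
    refine (hFn z).trans ?_
    have := fun i => (ha i).le
    have := fun k => (hb k).le
    refine Finset.sum_le_sum fun i _ => mul_le_mul (Finset.sum_le_sum fun k _ => ?_)
      (rpow_le_one_add (ha i) (by linarith) (by linarith)) (Real.rpow_nonneg (ha i).le _)
      (Finset.sum_nonneg fun k _ => mul_nonneg (by linarith [hb k]) (norm_nonneg _))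
    gcongr
    exact rpow_le_one_add (hb k) (by linarith) (by linarith)
  · intro z hz
    have hz' : z.re = 0 := by simpa using hz
    refine (hFn z).trans ?_
    rw [hz', Finset.mul_sum]
    refine Finset.sum_le_sum fun i _ => ?_
    simp only [zero_div, Real.rpow_zero, one_mul, sub_zero, Real.rpow_one]
    exact mul_le_mul_of_nonneg_right (h₁ i) (ha i).le
  · intro z hz
    have hz' : z.re = 1 := by simpa using hz
    refine (h₂ _ _).trans (le_of_eq ?_)
    simp only [hnb, hna, hz']
    have h3 : ∀ t : ℝ, 0 < t → (t ^ ((1 : ℝ) / 2)) ^ 2 = t := by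
      intro t ht
      rw [← Real.sqrt_eq_rpow, Real.sq_sqrt ht.le]
    have h4 : (1 - 1 / 2 : ℝ) = 1 / 2 := by norm_num
    simp only [h4, h3 _ (ha _), h3 _ (hb _)]

theorem norm_sum_smul_of_orthonormal {H : Type*} [NormedAddCommGroup H] [InnerProductSpace ℂ H]
    [Fintype ι] {u : ι → H} (hu : Orthonormal ℂ u) (c : ι → ℂ) :
    ‖∑ i, c i • u i‖ = √(∑ i, ‖c i‖ ^ 2) := by
  rw [norm_eq_sqrt_re_inner (𝕜 := ℂ), hu.inner_sum]
  congr 1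
  simp [Complex.conj_mul', ← Complex.ofReal_pow]

variable {H : Type*} [NormedAddCommGroup H] [InnerProductSpace ℂ H]

theorem orthonormal_inv_norm_smul {x : ι → H} (hx0 : ∀ i, x i ≠ 0)
    (hx : Pairwise fun i j => inner ℂ (x i) (x j) = 0) :
    Orthonormal ℂ fun i => ((‖x i‖⁻¹ : ℝ) : ℂ) • x i := by
  refine ⟨fun i => ?_, fun i j hij => ?_⟩
  · rw [norm_smul, Complex.norm_real, norm_inv, norm_norm, inv_mul_cancel₀]
    exact norm_ne_zero_iff.2 (hx0 i)
  · simp only [inner_smul_left, inner_smul_right, hx hij, mul_zero]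

/-- Interpolation, between `ℓ¹` and `ℓ²`, for an operator on a Hilbert space and two
finite orthogonal families. -/
theorem norm_sum_inner_le (T : H →L[ℂ] H) {A₁ A₂ : ℝ} (hA₁ : 0 ≤ A₁) (hA₂ : 0 ≤ A₂) (hT : ‖T‖ ≤ A₂)
    {x : ι → H} {y : κ → H}
    (hx : Pairwise fun i j => inner ℂ (x i) (x j) = 0)
    (hy : Pairwise fun i j => inner ℂ (y i) (y j) = 0) (S : Finset κ) (P : Finset ι)
    (hyS : ∀ k ∈ S, y k ≠ 0)
    (h₁ : ∀ i, ∑ k ∈ S, ‖y k‖⁻¹ * ‖inner ℂ (y k) (T (x i))‖ ≤ A₁ * ‖x i‖)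
    {p : ℝ} (hp1 : 1 ≤ p) (hp2 : p ≤ 2) :
    ‖∑ k ∈ S, ((‖y k‖ ^ (p - 2) : ℝ) : ℂ) * inner ℂ (y k) (T (∑ i ∈ P, x i))‖ ≤
      A₁ ^ (2 / p - 1) * A₂ ^ (2 - 2 / p) * (∑ i ∈ P, ‖x i‖ ^ p) ^ (1 / p) *
        (∑ k ∈ S, ‖y k‖ ^ p) ^ (1 - 1 / p) := by
  classical
  have hp0 : 0 < p := by linarith
  set P' := P.filter (fun i => x i ≠ 0) with hP'
  have hxP : ∀ i : P', x i ≠ 0 := fun i => (Finset.mem_filter.1 i.2).2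
  have hyS' : ∀ k : S, y k ≠ 0 := fun k => hyS k k.2
  set u : P' → H := fun i => ((‖x i‖⁻¹ : ℝ) : ℂ) • x i with hu
  set v : S → H := fun k => ((‖y k‖⁻¹ : ℝ) : ℂ) • y k with hv
  have hou : Orthonormal ℂ u := orthonormal_inv_norm_smul hxP
    fun i j hij => hx (fun h => hij (Subtype.ext h))
  have hov : Orthonormal ℂ v := orthonormal_inv_norm_smul hyS'
    fun i j hij => hy (fun h => hij (Subtype.ext h))
  have hinner : ∀ k i, inner ℂ (v k) (T (u i)) =
      ((‖y k‖⁻¹ : ℝ) : ℂ) * ((‖x i‖⁻¹ : ℝ) : ℂ) * inner ℂ (y k) (T (x i)) := by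
    intro k i
    rw [hv, hu, map_smul, inner_smul_left, inner_smul_right, Complex.conj_ofReal, mul_assoc]
  have hxn : ∀ i : P', 0 < ‖x i‖ := fun i => norm_pos_iff.2 (hxP i)
  have hyn : ∀ k : S, 0 < ‖y k‖ := fun k => norm_pos_iff.2 (hyS' k)
  have hθ1 : 2 / p ≤ 2 := by rw [div_le_iff₀ hp0]; linarith
  have hθ2 : 1 ≤ 2 / p := by rw [le_div_iff₀ hp0]; linarith
  -- With `θ = 2 - 2 / p`, the powers at `θ` are `‖x i‖` and `‖y k‖ ^ (p - 1)`, which undo the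
  -- normalization.
  have key := norm_bilin_le_of_column_of_l2 (fun (k : S) (i : P') => inner ℂ (v k) (T (u i)))
    (fun i => ‖x i‖ ^ p) (fun k => ‖y k‖ ^ p) (fun i => Real.rpow_pos_of_pos (hxn i) _)
    (fun k => Real.rpow_pos_of_pos (hyn k) _) (A₁ := A₁) (A₂ := A₂) ?_ ?_ (θ := 2 - 2 / p)
    (by linarith) (by linarith)
  · have hS : ∑ k : S, ‖y k‖ ^ p = ∑ k ∈ S, ‖y k‖ ^ p :=
      Finset.sum_coe_sort S fun k => ‖y k‖ ^ p
    have hP : ∑ i : P', ‖x i‖ ^ p = ∑ i ∈ P, ‖x i‖ ^ p := by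
      rw [Finset.sum_coe_sort P' fun i => ‖x i‖ ^ p]
      refine Finset.sum_filter_of_ne fun i _ h h0 => h ?_
      rw [h0, norm_zero, Real.zero_rpow hp0.ne']
    rw [hS, hP] at key
    refine le_of_eq_of_le ?_ (key.trans (le_of_eq ?_))
    · congr 1
      have hsum : ∑ i ∈ P, x i = ∑ i : P', x i := by
        rw [Finset.sum_coe_sort P' x]
        exact (Finset.sum_filter_ne_zero P).symm
      rw [hsum, ← Finset.sum_coe_sort S]
      refine Finset.sum_congr rfl fun k _ => ?_
      rw [map_sum, inner_sum, Finset.mul_sum]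
      refine Finset.sum_congr rfl fun i _ => ?_
      have e1 : (‖y k‖ ^ p) ^ ((2 - 2 / p) / 2) = ‖y k‖ ^ (p - 2) * ‖y k‖ := by
        rw [← Real.rpow_mul (norm_nonneg _), ← Real.rpow_add_one (hyn k).ne']
        congr 1
        field_simp
        ring
      have e2 : (‖x i‖ ^ p) ^ (1 - (2 - 2 / p) / 2) = ‖x i‖ := by
        rw [← Real.rpow_mul (norm_nonneg _)]
        have : p * (1 - (2 - 2 / p) / 2) = 1 := by field_simp; ring
        rw [this, Real.rpow_one]
      rw [e1, e2, hinner]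
      have hx' : (‖x i‖ : ℂ) ≠ 0 := by exact_mod_cast (hxn i).ne'
      have hy' : (‖y k‖ : ℂ) ≠ 0 := by exact_mod_cast (hyn k).ne'
      push_cast
      field_simp
    · have hX : 0 ≤ ∑ i ∈ P, ‖x i‖ ^ p := Finset.sum_nonneg fun i _ => by positivity
      have hY : 0 ≤ ∑ k ∈ S, ‖y k‖ ^ p := Finset.sum_nonneg fun i _ => by positivity
      set Λ := ∑ i ∈ P, ‖x i‖ ^ p
      set Y := ∑ k ∈ S, ‖y k‖ ^ p
      rw [Real.mul_rpow hA₁ hX, Real.mul_rpow (by positivity) (by positivity),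
        Real.mul_rpow (by positivity) (by positivity), Real.sqrt_eq_rpow, Real.sqrt_eq_rpow,
        ← Real.rpow_mul hX, ← Real.rpow_mul hY]
      have e3 : Λ ^ (1 / p) = Λ ^ (1 - (2 - 2 / p)) * Λ ^ (1 / 2 * (2 - 2 / p)) := by
        rw [← Real.rpow_add_of_nonneg hX (by linarith) (by linarith)]
        congr 1
        ring
      rw [e3]
      ring_nf
  · intro i
    rw [Finset.sum_coe_sort S fun k => ‖inner ℂ (((‖y k‖⁻¹ : ℝ) : ℂ) • y k) (T (u i))‖]
    rw [← mul_le_mul_iff_left₀ (hxn i), Finset.sum_mul]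
    refine le_of_eq_of_le (Finset.sum_congr rfl fun k hk => ?_) (h₁ i)
    rw [hu, map_smul, inner_smul_left, inner_smul_right, Complex.conj_ofReal, norm_mul, norm_mul,
      Complex.norm_real, Complex.norm_real, norm_inv, norm_inv, norm_norm, norm_norm]
    have := (hxn i).ne'
    field_simp
  · intro c d
    clear_value u v
    have e : ∑ k, ∑ i, c k * inner ℂ (v k) (T (u i)) * d i =
        inner ℂ (∑ k, starRingEnd ℂ (c k) • v k) (T (∑ i, d i • u i)) := by
      rw [sum_inner]
      refine Finset.sum_congr rfl fun k _ => ?_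
      rw [map_sum, inner_sum]
      refine Finset.sum_congr rfl fun i _ => ?_
      rw [map_smul, inner_smul_left, inner_smul_right, Complex.conj_conj]
      ring
    rw [e]
    refine (norm_inner_le_norm _ _).trans ?_
    rw [norm_sum_smul_of_orthonormal hov]
    simp only [RCLike.norm_conj]
    refine (mul_le_mul_of_nonneg_left (T.le_of_opNorm_le hT _) (Real.sqrt_nonneg _)).trans
      (le_of_eq ?_)
    rw [norm_sum_smul_of_orthonormal hou]
    ring

end Interpolation

/-! ### Decomposition of `L²` along the cubes -/

section Cut

variable {μ : Measure X}

/-- The function of `L²` which is equal to `f` on `s` and vanishes outside of `s`. -/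
def cut (s : Set X) (hs : MeasurableSet s) (f : Lp ℂ 2 μ) : Lp ℂ 2 μ :=
  ((Lp.memLp f).indicator hs).toLp _

theorem coeFn_cut {s : Set X} (hs : MeasurableSet s) (f : Lp ℂ 2 μ) :
    cut s hs f =ᵐ[μ] s.indicator f :=
  MemLp.coeFn_toLp _

theorem norm_cut {s : Set X} (hs : MeasurableSet s) (f : Lp ℂ 2 μ) :
    ‖cut s hs f‖ = (eLpNorm f 2 (μ.restrict s)).toReal := by
  rw [Lp.norm_def, eLpNorm_congr_ae (coeFn_cut hs f), eLpNorm_indicator_eq_eLpNorm_restrict hs]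

theorem ofReal_norm_cut {s : Set X} (hs : MeasurableSet s) (f : Lp ℂ 2 μ) :
    ENNReal.ofReal ‖cut s hs f‖ = eLpNorm f 2 (μ.restrict s) := by
  rw [norm_cut, ENNReal.ofReal_toReal]
  exact ((eLpNorm_mono_measure _ Measure.restrict_le_self).trans_lt (Lp.eLpNorm_lt_top f)).ne

theorem inner_cut_right {s : Set X} (hs : MeasurableSet s) (f g : Lp ℂ 2 μ) :
    inner ℂ g (cut s hs f) = ∫ y in s, inner ℂ (g y) (f y) ∂μ := by
  rw [L2.inner_def, ← integral_indicator hs]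
  refine integral_congr_ae ?_
  filter_upwards [coeFn_cut hs f] with y hy
  rw [hy]
  by_cases h : y ∈ s <;> simp [h]

theorem inner_cut_cut {s t : Set X} (hs : MeasurableSet s) (ht : MeasurableSet t) (f g : Lp ℂ 2 μ)
    (h : Disjoint s t) : inner ℂ (cut s hs f) (cut t ht g) = 0 := by
  rw [inner_cut_right, setIntegral_eq_zero_of_ae_eq_zero]
  filter_upwards [coeFn_cut hs f] with y hy hyt
  rw [hy, indicator_of_notMem (disjoint_right.1 h hyt), inner_zero_left]

theorem inner_cut_self {s : Set X} (hs : MeasurableSet s) (f g : Lp ℂ 2 μ) :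
    inner ℂ (cut s hs f) (cut s hs g) = inner ℂ (cut s hs f) g := by
  rw [L2.inner_def, L2.inner_def]
  refine integral_congr_ae ?_
  filter_upwards [coeFn_cut hs f, coeFn_cut hs g] with y h1 h2
  rw [h1, h2]
  by_cases h : y ∈ s <;> simp [h]

theorem hasSum_inner_cut {ι : Type*} [Countable ι] {R : ι → Set X} (hR : ∀ i, MeasurableSet (R i))
    (hRd : Pairwise (Function.onFun Disjoint R)) (hRμ : μ (⋃ i, R i)ᶜ = 0) (f g : Lp ℂ 2 μ) :
    HasSum (fun i => inner ℂ g (cut (R i) (hR i) f)) (inner ℂ g f) := by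
  simp only [inner_cut_right]
  have h := hasSum_integral_iUnion hR hRd (L2.integrable_inner (𝕜 := ℂ) g f).integrableOn
  rwa [setIntegral_congr_set (t := univ) (by rwa [ae_eq_univ]), setIntegral_univ] at h

/-- Interpolation between `X^{1,2}` and `L²`. -/
theorem sum_norm_cut_rpow_le {ι : Type*} [Countable ι] {R : ι → Set X}
    (hR : ∀ i, MeasurableSet (R i))
    (hRd : Pairwise (Function.onFun Disjoint R)) (hRμ : μ (⋃ i, R i)ᶜ = 0)
    (T : Lp ℂ 2 μ →L[ℂ] Lp ℂ 2 μ) {A₁ A₂ : ℝ} (hA₁ : 0 ≤ A₁) (hA₂ : 0 ≤ A₂) (hT : ‖T‖ ≤ A₂)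
    (h₁ : ∀ i (f : Lp ℂ 2 μ), (∀ᵐ y ∂μ, y ∉ R i → f y = 0) → ∀ S : Finset ι,
      ∑ k ∈ S, ‖cut (R k) (hR k) (T f)‖ ≤ A₁ * ‖f‖)
    {p : ℝ} (hp1 : 1 ≤ p) (hp2 : p ≤ 2) (F : Lp ℂ 2 μ) {Λ : ℝ}
    (hΛ : ∀ P : Finset ι, ∑ i ∈ P, ‖cut (R i) (hR i) F‖ ^ p ≤ Λ) (S : Finset ι) :
    ∑ k ∈ S, ‖cut (R k) (hR k) (T F)‖ ^ p ≤ (A₁ ^ (2 / p - 1) * A₂ ^ (2 - 2 / p)) ^ p * Λ := by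
  classical
  have hp0 : 0 < p := by linarith
  have hΛ0 : 0 ≤ Λ := by simpa using hΛ ∅
  set y : ι → Lp ℂ 2 μ := fun k => cut (R k) (hR k) (T F) with hy
  set x : ι → Lp ℂ 2 μ := fun i => cut (R i) (hR i) F with hx
  set A := A₁ ^ (2 / p - 1) * A₂ ^ (2 - 2 / p) with hA
  have hA0 : 0 ≤ A := by positivity
  set S' := S.filter (fun k => y k ≠ 0) with hS'
  have hSS : ∑ k ∈ S, ‖y k‖ ^ p = ∑ k ∈ S', ‖y k‖ ^ p := by
    refine (Finset.sum_filter_of_ne (p := fun k => y k ≠ 0) fun k _ h h0 => h ?_).symm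
    rw [h0, norm_zero, Real.zero_rpow hp0.ne']
  change ∑ k ∈ S, ‖y k‖ ^ p ≤ _
  rw [hSS]
  set Y := ∑ k ∈ S', ‖y k‖ ^ p with hY
  have hY0 : 0 ≤ Y := Finset.sum_nonneg fun _ _ => by positivity
  -- Pairing `T F` with the dual element `∑ ‖y k‖ ^ (p - 2) y k` returns `Y`. In the limit over `P`,
  -- `Y ≤ A Λ ^ (1 / p) Y ^ (1 - 1 / p)`, and the finite `Y` can be divided out.
  have hbound : ∀ P : Finset ι,
      ‖∑ k ∈ S', ((‖y k‖ ^ (p - 2) : ℝ) : ℂ) * inner ℂ (y k) (T (∑ i ∈ P, x i))‖ ≤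
        A * Λ ^ (1 / p) * Y ^ (1 - 1 / p) := by
    intro P
    refine (norm_sum_inner_le T hA₁ hA₂ hT (x := x) (y := y)
      (fun i j hij => inner_cut_cut _ _ _ _ (hRd hij))
      (fun i j hij => inner_cut_cut _ _ _ _ (hRd hij)) S' P
      (fun k hk => (Finset.mem_filter.1 hk).2) (fun i => ?_) hp1 hp2).trans ?_
    · refine le_trans (Finset.sum_le_sum fun k hk => ?_) (h₁ i (x i) ?_ S')
      · have hk0 : 0 < ‖y k‖ := norm_pos_iff.2 (Finset.mem_filter.1 hk).2
        rw [inv_mul_le_iff₀ hk0]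
        simp only [hy]
        rw [← inner_cut_self]
        exact norm_inner_le_norm _ _
      · filter_upwards [coeFn_cut (hR i) F] with z hz hzR
        simp only [hx]
        rw [hz, indicator_of_notMem hzR]
    · gcongr
      exact hΛ P
  have hlim : Filter.Tendsto (fun P : Finset ι =>
      ‖∑ k ∈ S', ((‖y k‖ ^ (p - 2) : ℝ) : ℂ) * inner ℂ (y k) (T (∑ i ∈ P, x i))‖) Filter.atTop
      (nhds ‖∑ k ∈ S', ((‖y k‖ ^ (p - 2) : ℝ) : ℂ) * inner ℂ (y k) (T F)‖) := by
    refine (tendsto_finsetSum _ fun k _ => Filter.Tendsto.const_mul _ ?_).norm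
    -- Only scalar products occur, so weak convergence of the partial sums to `F` is enough.
    have h := hasSum_inner_cut hR hRd hRμ F (ContinuousLinearMap.adjoint T (y k))
    simp only [ContinuousLinearMap.adjoint_inner_left] at h
    refine h.congr fun P => ?_
    rw [map_sum, inner_sum]
  have hlast : ‖∑ k ∈ S', ((‖y k‖ ^ (p - 2) : ℝ) : ℂ) * inner ℂ (y k) (T F)‖ = Y := by
    have : ∑ k ∈ S', ((‖y k‖ ^ (p - 2) : ℝ) : ℂ) * inner ℂ (y k) (T F) = ((Y : ℝ) : ℂ) := by
      rw [hY, Complex.ofReal_sum]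
      refine Finset.sum_congr rfl fun k hk => ?_
      have hk0 : 0 < ‖y k‖ := norm_pos_iff.2 (Finset.mem_filter.1 hk).2
      have e : inner ℂ (y k) (T F) = ((‖y k‖ ^ 2 : ℝ) : ℂ) := by
        simp only [hy]
        rw [← inner_cut_self, inner_self_eq_norm_sq_to_K]
        norm_cast
      rw [e, ← Complex.ofReal_mul, ← Real.rpow_natCast, ← Real.rpow_add hk0]
      norm_num
    rw [this, Complex.norm_real, Real.norm_of_nonneg hY0]
  have hfin := le_of_tendsto' hlim hbound
  rw [hlast] at hfin
  rcases eq_or_lt_of_le hY0 with h0 | h0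
  · rw [← h0]
    positivity
  · have h2 : Y ^ (1 / p) * Y ^ (1 - 1 / p) = Y := by
      rw [← Real.rpow_add h0]
      simp
    have h3 : Y ^ (1 / p) ≤ A * Λ ^ (1 / p) := by
      refine le_of_mul_le_mul_right ?_ (Real.rpow_pos_of_pos h0 (1 - 1 / p))
      rwa [h2]
    have h4 := Real.rpow_le_rpow (by positivity) h3 hp0.le
    rwa [Real.mul_rpow hA0 (by positivity), ← Real.rpow_mul hY0, ← Real.rpow_mul hΛ0,
      one_div_mul_cancel hp0.ne', Real.rpow_one, Real.rpow_one] at h4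

end Cut

/-! ### Amalgam norms and the theorem -/

theorem IsDoubling.mono {μ : Measure X} {n Cd Cd' : ℝ} (h : IsDoubling μ n Cd) (hC : Cd ≤ Cd') :
    IsDoubling μ n Cd' where
  finite_ball := h.finite_ball
  ball_le x r hr t ht := (h.ball_le x r hr t ht).trans (by gcongr)

theorem DyadicCubes.amalgamNorm_of_ne_top {μ : Measure X} {c₀ C₀ : ℝ} (𝒬 : DyadicCubes μ c₀ C₀)
    (ν : ℤ) {p : ℝ≥0∞} (hp : p ≠ ∞) (q : ℝ≥0∞) (f : X → ℂ) :
    𝒬.amalgamNorm ν p q f =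
      (∑' Q : 𝒬.cubes ν, eLpNorm f q (μ.restrict (Q : Set X)) ^ p.toReal) ^ (1 / p.toReal) :=
  if_neg hp

/-- This is `ℓ^p ⊆ ℓ²`: each local norm is at most `s ^ (1 / p)`, so its square is at most its
`p`-th power times `(s ^ (1 / p)) ^ (2 - p)`. -/
theorem memLp_two_of_tsum {μ : Measure X} {ι : Type*} [Countable ι] {R : ι → Set X}
    (hR : ∀ i, MeasurableSet (R i))
    (hRd : Pairwise (Function.onFun Disjoint R)) (hRμ : μ (⋃ i, R i)ᶜ = 0) {f : X → ℂ}
    (hf : AEStronglyMeasurable f μ) {p : ℝ} (hp0 : 0 < p) (hp2 : p ≤ 2)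
    (h : ∑' i, eLpNorm f 2 (μ.restrict (R i)) ^ p ≠ ∞) : MemLp f 2 μ := by
  refine ⟨hf, ?_⟩
  set s := ∑' i, eLpNorm f 2 (μ.restrict (R i)) ^ p with hs
  have h1 : eLpNorm f 2 μ ^ 2 = ∑' i, eLpNorm f 2 (μ.restrict (R i)) ^ (2 : ℝ) := by
    rw [eLpNorm_two_sq, ← setLIntegral_univ, ← setLIntegral_congr (s := ⋃ i, R i) (by
      rwa [ae_eq_univ]), lintegral_iUnion hR hRd]
    refine tsum_congr fun i => ?_
    rw [← eLpNorm_two_sq]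
    norm_num
  have h2 : eLpNorm f 2 μ ^ 2 ≤ s * (s ^ (1 / p)) ^ (2 - p) := by
    rw [h1]
    nth_rewrite 1 [hs]
    rw [← ENNReal.tsum_mul_right]
    refine ENNReal.tsum_le_tsum fun i => ?_
    rw [show (2 : ℝ) = p + (2 - p) by ring, ENNReal.rpow_add_of_nonneg _ _ hp0.le (by linarith),
      show p + (2 - p) - p = 2 - p by ring]
    gcongr
    rw [one_div, ENNReal.le_rpow_inv_iff hp0]
    exact ENNReal.le_tsum i
  have h3 : s * (s ^ (1 / p)) ^ (2 - p) < ∞ :=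
    ENNReal.mul_lt_top h.lt_top (ENNReal.rpow_lt_top_of_nonneg (by linarith)
      (ENNReal.rpow_ne_top_of_nonneg (by positivity) h))
  by_contra htop
  rw [not_lt, top_le_iff] at htop
  rw [htop] at h2
  simp only [ENNReal.top_pow two_ne_zero, top_le_iff] at h2
  exact h3.ne h2

end Amalgam

end

theorem theorem2p3 (n Cd c₀ C₀ K₀ M : ℝ) (ℓ : ℕ) (hn : 0 < n) (hc₀ : 0 < c₀) (hK₀ : 0 < K₀) :
    ∃ C : ℝ, 0 < C ∧
      ∀ (X : Type*) [MetricSpace X] [MeasurableSpace X] [BorelSpace X] (μ : Measure X),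
        Amalgam.IsDoubling μ n Cd →
      ∀ (𝒬 : Amalgam.DyadicCubes μ c₀ C₀)
        (w : X → X → EuclideanSpace ℝ (Fin ℓ)), Amalgam.IsWeight μ K₀ w →
      ∀ (D : Amalgam.TestSpace μ w) (T : Lp ℂ 2 μ →L[ℂ] Lp ℂ 2 μ), ‖T‖ ≤ M →
      ∀ B₀ : ℝ, 1 ≤ B₀ →
        (∀ k : ℕ, 1 ≤ k → k ≤ ⌊n / 2⌋₊ + 1 → ∀ (z : X) (j : Fin ℓ),
          D.ExtendsWithNormLE (D.Ad z j T k) (B₀ ^ k)) →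
      ∀ p : ℝ≥0∞, 1 ≤ p → p ≤ 2 →
      ∀ f : X → ℂ, AEStronglyMeasurable f μ → 𝒬.amalgamNorm 0 p 2 f < ∞ →
        ∃ hf : MemLp f 2 μ,
          𝒬.amalgamNorm 0 p 2 (T (hf.toLp f)) ≤
            ENNReal.ofReal (C * B₀ ^ (n * (1 / p.toReal - 1 / 2))) * 𝒬.amalgamNorm 0 p 2 f := by
  set N := ⌊n / 2⌋₊ + 1 with hN
  set r := max C₀ 0 with hr
  set M' := max M 1 with hM'
  obtain ⟨K, hK⟩ : ∃ K : ℝ, K = √(2 ^ (2 * N) * ((1 + r) ^ (2 * N) +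
      K₀ ^ (2 * N) * (ℓ : ℝ) ^ (N + 1) * (K₀ * r + 1) ^ (2 * N)) * M' ^ 2 *
        (2 ^ (2 * N) * max Cd 0 * (1 + 2 / c₀) ^ n * (1 - (2 : ℝ) ^ (n - 2 * N))⁻¹)) := ⟨_, rfl⟩
  have hK0 : 0 ≤ K := hK ▸ Real.sqrt_nonneg _
  have hM1 : 1 ≤ M' := le_max_right _ _
  have hnN : n < 2 * N := by
    have := Nat.lt_floor_add_one (n / 2)
    rw [hN]
    push_cast
    linarith
  -- Interpolation gives `K ^ (2 / q - 1) * M' ^ (2 - 2 / q)`; both exponents lie in `[0, 1]`, so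
  -- bases at least `1` make the constant independent of `p`.
  refine ⟨max K 1 * M', by positivity, ?_⟩
  intro X _ _ _ μ hμd 𝒬 w hw D T hTM B₀ hB₀ hAd p hp1 hp2 f hf hfX
  have hptop : p ≠ ∞ := (hp2.trans_lt (by simp)).ne
  set q := p.toReal with hq
  have hq1 : 1 ≤ q := by simpa using ENNReal.toReal_mono hptop hp1
  have hq2 : q ≤ 2 := by simpa using ENNReal.toReal_mono (by simp) hp2
  have hq0 : 0 < q := by linarith
  -- Counting needs balls of positive measure; for `μ = 0` all norms vanish.
  by_cases hμ : μ = 0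
  · subst hμ
    refine ⟨by simp, ?_⟩
    rw [𝒬.amalgamNorm_of_ne_top 0 hptop]
    simp [← hq, hq0]
  obtain ⟨x, hx⟩ := 𝒬.exists_center
  have hRd := 𝒬.pairwise_disjoint 0
  have hRm := 𝒬.measurableSet 0
  have hd' := hμd.mono (le_max_left Cd 0)
  have : Countable (𝒬.cubes 0) := hd'.countable hμ hc₀ (x := x)
    fun i j hij => (hRd hij).mono (hx i).1 (hx j).1
  have hRμ : μ (⋃ Q : 𝒬.cubes 0, (Q : Set X))ᶜ = 0 := by
    rw [← sUnion_eq_iUnion]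
    exact 𝒬.ae_cover 0
  rw [𝒬.amalgamNorm_of_ne_top 0 hptop] at hfX
  have hsum : ∑' Q : 𝒬.cubes 0, eLpNorm f 2 (μ.restrict (Q : Set X)) ^ q ≠ ∞ := by
    intro h
    rw [← hq, h, ENNReal.top_rpow_of_pos (by positivity)] at hfX
    exact lt_irrefl _ hfX
  have hfL := Amalgam.memLp_two_of_tsum hRm hRd hRμ hf hq0 hq2 hsum
  refine ⟨hfL, ?_⟩
  set F := hfL.toLp f with hF
  have hcut : ∀ Q : 𝒬.cubes 0, ENNReal.ofReal ‖Amalgam.cut (Q : Set X) (hRm Q) F‖ =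
      eLpNorm f 2 (μ.restrict (Q : Set X)) := fun Q => by
    rw [Amalgam.ofReal_norm_cut]
    exact eLpNorm_congr_ae (ae_restrict_of_ae hfL.coeFn_toLp)
  have hxr : ∀ Q : 𝒬.cubes 0, (Q : Set X) ⊆ ball (x Q) r :=
    fun Q => (hx Q).2.trans (ball_subset_ball (le_max_left _ _))
  have hmain := Amalgam.sum_norm_cut_rpow_le hRm hRd hRμ T (A₁ := K * B₀ ^ (n / 2)) (A₂ := M')
    (by positivity) (by positivity) (hTM.trans (le_max_left _ _)) (fun i g hg S => by
      simp only [Amalgam.norm_cut]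
      rw [hK]
      refine D.sum_eLpNorm_le hw hK₀ hn (le_max_right _ _) hd' hμ T
        (hTM.trans (le_max_left _ _)) hM1 hB₀ hnN (x i)
        (fun k h1 h2 j => hAd k h1 h2 (x i) j) (le_max_right _ _) hc₀ g ?_ S _ x hRm hRd
        (fun Q => (hx Q).1) hxr
      filter_upwards [hg] with y hy hyr
      exact hy fun h => hyr (hxr i h)) hq1 hq2 F
    (Λ := (∑' Q : 𝒬.cubes 0, eLpNorm f 2 (μ.restrict (Q : Set X)) ^ q).toReal) (fun P => by
      rw [← ENNReal.ofReal_le_ofReal_iff ENNReal.toReal_nonneg, ENNReal.ofReal_toReal hsum,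
        ENNReal.ofReal_sum_of_nonneg fun _ _ => by positivity]
      refine le_trans (le_of_eq (Finset.sum_congr rfl fun Q _ => ?_)) (ENNReal.sum_le_tsum P)
      rw [← ENNReal.ofReal_rpow_of_nonneg (norm_nonneg _) hq0.le, hcut])
  set A := (K * B₀ ^ (n / 2)) ^ (2 / q - 1) * M' ^ (2 - 2 / q) with hA
  have hA0 : 0 ≤ A := by positivity
  have hθ1 : 2 / q ≤ 2 := by rw [div_le_iff₀ hq0]; linarith
  have hθ2 : 1 ≤ 2 / q := by rw [le_div_iff₀ hq0]; linarith
  have hAC : A ≤ max K 1 * M' * B₀ ^ (n * (1 / q - 1 / 2)) := by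
    have e1 : (K * B₀ ^ (n / 2)) ^ (2 / q - 1) ≤ max K 1 * B₀ ^ (n * (1 / q - 1 / 2)) := by
      rw [Real.mul_rpow hK0 (by positivity), ← Real.rpow_mul (by linarith),
        show n / 2 * (2 / q - 1) = n * (1 / q - 1 / 2) by ring]
      gcongr
      calc K ^ (2 / q - 1) ≤ max K 1 ^ (2 / q - 1) :=
            Real.rpow_le_rpow hK0 (le_max_left _ _) (by linarith)
        _ ≤ max K 1 ^ (1 : ℝ) :=
            Real.rpow_le_rpow_of_exponent_le (le_max_right _ _) (by linarith)
        _ = max K 1 := Real.rpow_one _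
    have e2 : M' ^ (2 - 2 / q) ≤ M' := by
      calc M' ^ (2 - 2 / q) ≤ M' ^ (1 : ℝ) :=
            Real.rpow_le_rpow_of_exponent_le hM1 (by linarith)
        _ = M' := Real.rpow_one _
    calc A ≤ max K 1 * B₀ ^ (n * (1 / q - 1 / 2)) * M' :=
            mul_le_mul e1 e2 (by positivity) (by positivity)
      _ = _ := by ring
  rw [𝒬.amalgamNorm_of_ne_top 0 hptop, 𝒬.amalgamNorm_of_ne_top 0 hptop, ← hq]
  have hle : ∑' Q : 𝒬.cubes 0, eLpNorm (T F) 2 (μ.restrict (Q : Set X)) ^ q ≤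
      ENNReal.ofReal A ^ q * ∑' Q : 𝒬.cubes 0, eLpNorm f 2 (μ.restrict (Q : Set X)) ^ q := by
    rw [ENNReal.tsum_eq_iSup_sum]
    refine iSup_le fun S => ?_
    have := ENNReal.ofReal_le_ofReal (hmain S)
    rw [ENNReal.ofReal_mul (by positivity), ENNReal.ofReal_toReal hsum,
      ← ENNReal.ofReal_rpow_of_nonneg hA0 hq0.le,
      ENNReal.ofReal_sum_of_nonneg fun _ _ => by positivity] at this
    refine le_trans (le_of_eq (Finset.sum_congr rfl fun Q _ => ?_)) this
    rw [← ENNReal.ofReal_rpow_of_nonneg (norm_nonneg _) hq0.le, Amalgam.ofReal_norm_cut]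
  calc _ ≤ (ENNReal.ofReal A ^ q *
        ∑' Q : 𝒬.cubes 0, eLpNorm f 2 (μ.restrict (Q : Set X)) ^ q) ^ (1 / q) := by gcongr
    _ = ENNReal.ofReal A *
        (∑' Q : 𝒬.cubes 0, eLpNorm f 2 (μ.restrict (Q : Set X)) ^ q) ^ (1 / q) := by
      rw [ENNReal.mul_rpow_of_nonneg _ _ (by positivity), ← ENNReal.rpow_mul,
        mul_one_div_cancel hq0.ne', ENNReal.rpow_one]
    _ ≤ _ := by gcongr
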